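/- Let $\hat f(\xi)=\int_{\mathbb R^d} f(x)e^{-2\pi i x\cdot\xi}\,dx$ denote the Fourier transform, extended to a unitary operator on $L^2(\mathbb R^d)$, and let $T_\beta f(x)=f(x-\beta)$ for $\beta\in\mathbb R^d$. Let $\mathcal D$ be the set of $f\in L^2(\mathbb R^d)$ such that $\hat f\in L^\infty(\mathbb R^d)$ and $\operatorname{supp}\hat f$ is compact and does not contain $0$. Let $\mathcal P$ be a countable index set, let $C_p$ be an invertible real $d\times d$ matrix for each $p\in\mathcal P$, put $C_p'=(C_p^{*})^{-1}$, where $C_p^*$ is the transpose, and $$\Lambda=\bigcup_{p\in\mathcal P}C_p'\mathbb Z^d,\qquad \mathcal P_\alpha=\{p\in\mathcal P: C_p^{*}\alpha\in\mathbb Z^d\}\quad(\alpha\in\Lambda).$$ Let $g_p,h_p\in L^2(\mathbb R^d)$ ($p\in\mathcal P$). Suppose that each of the systems $\{T_{C_pk}g_p\}_{p\in\mathcal P,\,k\in\mathbb Z^d}$ and $\{T_{C_pk}h_p\}_{p\in\mathcal P,\,k\in\mathbb Z^d}$ satisfies the Bessel condition and the local integrability condition; that is, with $u=g$ and with $u=h$,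 there is $M<\infty$ such that $$\sum_{p\in\mathcal P}\sum_{k\in\mathbb Z^d}|\langle f,T_{C_pk}u_p\rangle|^2\le M\|f\|^2\quad\text{for all } f\in L^2(\mathbb R^d),$$ and $$\sum_{p\in\mathcal P}\sum_{k\in\mathbb Z^d}\int_{\operatorname{supp}\hat f}|\hat f(\xi+C_p'k)|^2\,|\det C_p|^{-1}\,|\hat u_p(\xi)|^2\,d\xi<\infty\quad\text{for all } f\in\mathcal D.$$ Let $\theta_g,\theta_h: L^2(\mathbb R^d)\to\ell^2(\mathcal P\times\mathbb Z^d)$ be the analysis operators $\theta_u f=(\langle f,T_{C_pk}u_p\rangle)_{p,k}$, and let $\Theta=\theta_g^{*}\theta_h$. Then $$\Theta f=\sum_{p\in\mathcal P}\sum_{k\in\mathbb Z^d}\langle f,T_{C_pk}h_p\rangle\,T_{C_pk}g_p\quad\text{for all } f\in L^2(\mathbb R^d),$$ with unconditional convergence in $L^2(\mathbb R^d)$. For every $\alpha\in\Lambda$ the series $\sum_{p\in\mathcal P_\alpha}|\det C_p|^{-1}\overline{\hat h_p(\xi)}\,\hat g_p(\xi+\alpha)$ converges absolutely for a.e. $\xi$.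 The operator $\Theta$ commutes with $T_\beta$ for all $\beta\in\mathbb R^d$ if and only if for every $\alpha\in\Lambda\setminus\{0\}$ $$\sum_{p\in\mathcal P_\alpha}|\det C_p|^{-1}\,\overline{\hat h_p(\xi)}\,\hat g_p(\xi+\alpha)=0\quad\text{for a.e. }\xi\in\mathbb R^d.$$ In this case $\Theta$ is a Fourier multiplier with symbol $$s(\xi)=\sum_{p\in\mathcal P}|\det C_p|^{-1}\,\overline{\hat h_p(\xi)}\,\hat g_p(\xi)$$ (this series converges absolutely for a.e. $\xi$), that is, $s\in L^\infty(\mathbb R^d)$ and $\widehat{\Theta f}(\xi)=s(\xi)\hat f(\xi)$ for a.e. $\xi$, for every $f\in L^2(\mathbb R^d)$. -/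

import Mathlib

open MeasureTheory FourierTransform
open scoped ENNReal NNReal Topology ComplexConjugate

noncomputable section

/-! ### Bessel sequences, analysis operators and mixed dual Gramians in a Hilbert space -/

section Bessel

variable {H : Type*} [NormedAddCommGroup H] [InnerProductSpace ℂ H] {ι : Type*}

/-- `x` is a Bessel sequence: there is a finite `M` with `∑ |⟨v, x_j⟩|² ≤ M ‖v‖²` for all `v`.
Mathlib's inner product is conjugate linear in its first argument, so the usual `⟨v, x_j⟩`
(linear in `v`) is `inner ℂ (x j) v`. -/
def IsBessel (x : ι → H) : Prop :=
  ∃ M : ℝ≥0, ∀ v : H, ∑' j, ‖inner ℂ (x j) v‖ₑ ^ 2 ≤ (M : ℝ≥0∞) * ‖v‖ₑ ^ 2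

theorem IsBessel.exists_bound {x : ι → H} (hx : IsBessel x) :
    ∃ M : ℝ≥0, ∀ v : H, Summable (fun j => ‖inner ℂ (x j) v‖ ^ 2) ∧
      ∑' j, ‖inner ℂ (x j) v‖ ^ 2 ≤ M * ‖v‖ ^ 2 := by
  obtain ⟨M, hM⟩ := hx
  refine ⟨M, fun v => ?_⟩
  have h1 : ∑' j, ((‖inner ℂ (x j) v‖₊ ^ 2 : ℝ≥0) : ℝ≥0∞)
      ≤ ((M * ‖v‖₊ ^ 2 : ℝ≥0) : ℝ≥0∞) := by
    have := hM v
    simpa [enorm_eq_nnnorm] using this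
  have hs : Summable (fun j => (‖inner ℂ (x j) v‖₊ ^ 2 : ℝ≥0)) :=
    ENNReal.tsum_coe_ne_top_iff_summable.1 (ne_top_of_le_ne_top ENNReal.coe_ne_top h1)
  refine ⟨by simpa using NNReal.summable_coe.2 hs, ?_⟩
  rw [← ENNReal.coe_tsum hs, ENNReal.coe_le_coe, ← NNReal.coe_le_coe] at h1
  simpa [NNReal.coe_tsum] using h1

theorem IsBessel.memℓp {x : ι → H} (hx : IsBessel x) (v : H) :
    Memℓp (fun j => (inner ℂ (x j) v : ℂ)) 2 := by
  obtain ⟨M, hM⟩ := hx.exists_bound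
  refine memℓp_gen ?_
  simpa using (hM v).1

/-- The analysis operator `v ↦ (⟨v, x_j⟩)_j` of a Bessel sequence, as a bounded operator into
`ℓ²`. -/
def analysisOp (x : ι → H) (hx : IsBessel x) : H →L[ℂ] lp (fun _ : ι => ℂ) 2 :=
  LinearMap.mkContinuousOfExistsBound
    { toFun := fun v => ⟨fun j => inner ℂ (x j) v, hx.memℓp v⟩
      map_add' := fun v w => by ext j; exact inner_add_right _ _ _
      map_smul' := fun c v => by ext j; exact inner_smul_right _ _ _ }
    (by
      obtain ⟨M, hM⟩ := hx.exists_bound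
      refine ⟨Real.sqrt M, fun v => ?_⟩
      refine lp.norm_le_of_tsum_le (by norm_num) (by positivity) ?_
      simpa [mul_pow] using (hM v).2)

variable [CompleteSpace H]

/-- The operator `θ_y^* θ_x`, where `θ_y^*` is the adjoint of the analysis operator, that is, the
synthesis operator of `y`. -/
def mixedGramian (x y : ι → H) (hx : IsBessel x) (hy : IsBessel y) : H →L[ℂ] H :=
  (ContinuousLinearMap.adjoint (analysisOp y hy)).comp (analysisOp x hx)

end Bessel

/-! ### Translations and Fourier multipliers on `L²(ℝᵈ)` -/

/-- `L²(ℝᵈ)`, with complex values and Lebesgue measure. Its Fourier transform `𝓕` is Mathlib's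
unitary extension of `f ↦ ∫ f(x) exp(-2πi x·ξ) dx`. -/
abbrev L2Space (d : ℕ) : Type := Lp ℂ 2 (volume : Measure (EuclideanSpace ℝ (Fin d)))

/-- The translation operator `(T_β f)(x) = f(x - β)`. -/
def translationOp {d : ℕ} (β : EuclideanSpace ℝ (Fin d)) : L2Space d →L[ℂ] L2Space d :=
  (Lp.compMeasurePreservingₗᵢ ℂ (fun x => x - β)
    (measurePreserving_sub_right volume β)).toContinuousLinearMap

/-- `Θ` is the Fourier multiplier with the essentially bounded symbol `s`. -/
def IsFourierMultiplier {d : ℕ} (Θ : L2Space d →L[ℂ] L2Space d)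
    (s : EuclideanSpace ℝ (Fin d) → ℂ) : Prop :=
  MemLp s ∞ volume ∧
    ∀ f : L2Space d, (𝓕 (Θ f) : L2Space d) =ᵐ[volume] fun ξ => s ξ * (𝓕 f : L2Space d) ξ

/-- The (closed, essential) support of a function defined up to null sets: the complement of the
largest open set on which it vanishes almost everywhere. -/
def essSupport {d : ℕ} (φ : EuclideanSpace ℝ (Fin d) → ℂ) : Set (EuclideanSpace ℝ (Fin d)) :=
  {ξ | ∀ U ∈ 𝓝 ξ, ¬ φ =ᵐ[volume.restrict U] 0}

/-- The space `𝒟` of those `f ∈ L²(ℝᵈ)` for which `𝓕 f` is essentially bounded and has compact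
support not containing the origin. -/
def testSpace (d : ℕ) : Set (L2Space d) :=
  {f | MemLp (𝓕 f : L2Space d) ∞ volume ∧ IsCompact (essSupport (𝓕 f : L2Space d)) ∧
    0 ∉ essSupport (𝓕 f : L2Space d)}

/-! ### General translation systems -/

/-- The vector `A k ∈ ℝᵈ` for a matrix `A` and `k ∈ ℤᵈ`. -/
def latticePoint {d : ℕ} (A : Matrix (Fin d) (Fin d) ℝ) (k : Fin d → ℤ) :
    EuclideanSpace ℝ (Fin d) :=
  WithLp.toLp 2 (A.mulVec fun i => (k i : ℝ))

/-- `C' = (C^*)⁻¹`, the inverse of the transpose. -/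
def dualMatrix {d : ℕ} (C : Matrix (Fin d) (Fin d) ℝ) : Matrix (Fin d) (Fin d) ℝ :=
  (C.transpose)⁻¹

/-- The system `{T_{C_p k} g_p : p ∈ P, k ∈ ℤᵈ}`. -/
def translationSystem {d : ℕ} {P : Type*} (C : P → Matrix (Fin d) (Fin d) ℝ) (g : P → L2Space d) :
    P × (Fin d → ℤ) → L2Space d :=
  fun pk => translationOp (latticePoint (C pk.1) pk.2) (g pk.1)

/-- The local integrability condition: for all `f ∈ 𝒟`,
`∑_p ∑_k ∫_{supp 𝓕 f} |𝓕 f (ξ + C_p' k)|² |det C_p|⁻¹ |𝓕 g_p (ξ)|² dξ < ∞`. -/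
def LocallyIntegrableSystem {d : ℕ} {P : Type*} (C : P → Matrix (Fin d) (Fin d) ℝ)
    (g : P → L2Space d) : Prop :=
  ∀ f ∈ testSpace d,
    ∑' (p : P) (k : Fin d → ℤ), ∫⁻ ξ in essSupport (𝓕 f : L2Space d),
      ‖(𝓕 f : L2Space d) (ξ + latticePoint (dualMatrix (C p)) k)‖ₑ ^ 2 *
        ENNReal.ofReal |(C p).det|⁻¹ * ‖(𝓕 (g p) : L2Space d) ξ‖ₑ ^ 2 < ⊤

/-- `Λ = ⋃_p C_p' ℤᵈ`. -/
def frequencySet {d : ℕ} {P : Type*} (C : P → Matrix (Fin d) (Fin d) ℝ) :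
    Set (EuclideanSpace ℝ (Fin d)) :=
  ⋃ p, Set.range (latticePoint (dualMatrix (C p)))

/-- `P_α = {p : C_p^* α ∈ ℤᵈ}`. -/
def activeIndices {d : ℕ} {P : Type*} (C : P → Matrix (Fin d) (Fin d) ℝ)
    (α : EuclideanSpace ℝ (Fin d)) : Set P :=
  {p | ∃ k : Fin d → ℤ, (C p).transpose.mulVec α = fun i => (k i : ℝ)}

/-- The term `|det C_p|⁻¹ conj(𝓕 h_p (ξ)) 𝓕 g_p (ξ + α)`. -/
def crossTerm {d : ℕ} {P : Type*} (C : P → Matrix (Fin d) (Fin d) ℝ) (g h : P → L2Space d)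
    (α ξ : EuclideanSpace ℝ (Fin d)) (p : P) : ℂ :=
  ((|(C p).det|⁻¹ : ℝ) : ℂ) * conj ((𝓕 (h p) : L2Space d) ξ) * (𝓕 (g p) : L2Space d) (ξ + α)

end

/-!
A translation multiplies `𝓕 f` by a character, so it cancels from `𝓕 f₁(ξ) conj(𝓕 f₂(ξ))` but
leaves the character of `α` on the cross-spectrum `𝓕 f₁(ξ) conj(𝓕 f₂(ξ + α))`. For band-limited
`f₁` and `f₂`, Parseval's identity on the tori `ℝᵈ / C_p' ℤᵈ` therefore expands
`x ↦ ⟨Θ T_x f₁, T_x f₂⟩` into an absolutely convergent series of the characters with frequencies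
`α ∈ Λ`, and the coefficient of `α` is the integral of the cross-spectrum against
`∑_{p ∈ P_α} |det C_p|⁻¹ conj(𝓕 h_p(ξ)) 𝓕 g_p(ξ + α)`. If `Θ` commutes with the translations, this
almost periodic function is constant, so its coefficients at `α ≠ 0` vanish, and testing with
indicator functions on the Fourier side makes the sums themselves vanish. Conversely, if they
vanish, only `α = 0` remains: on the Fourier side `Θ` acts as multiplication by `s`, which is
bounded by `‖Θ‖` because its averages are, and Fourier multipliers commute.
-/

/-! ### Periodizations on the torus -/

section Torus

variable {ι : Type*}

theorem ennreal_mul_le_sq_add_sq (a b : ℝ≥0∞) : a * b ≤ a ^ 2 + b ^ 2 := by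
  rcases le_total a b with h | h
  · exact (mul_le_mul_left h b).trans ((sq b).symm.le.trans le_add_self)
  · exact (mul_le_mul_right h a).trans ((sq a).symm.le.trans le_self_add)

/-- The integer vector `m`, regarded as a real vector. -/
def intVec (m : ι → ℤ) : ι → ℝ := fun i => m i

theorem intVec_add (m n : ι → ℤ) : intVec (m + n) = intVec m + intVec n := by
  ext i
  simp [intVec]

/-- The cube of side length one with lower corner `a`, half open so that its integer translates
tile the space. -/
def unitCube (a : ι → ℝ) : Set (ι → ℝ) := {x | ∀ i, x i ∈ Set.Ioc (a i) (a i + 1)}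

theorem mem_unitCube_intVec_iff (m : ι → ℤ) (x : ι → ℝ) :
    x ∈ unitCube (intVec m) ↔ (fun i => ⌈x i⌉ - 1) = m := by
  simp only [unitCube, intVec, Set.mem_ofPred_eq, Set.mem_Ioc, funext_iff]
  refine forall_congr' fun i => ?_
  rw [sub_eq_iff_eq_add, Int.ceil_eq_iff]
  push_cast
  simp

theorem pairwise_disjoint_unitCube :
    Pairwise (Function.onFun Disjoint fun m : ι → ℤ => unitCube (intVec m)) := by
  intro m n hmn
  refine Set.disjoint_left.2 fun x hx hx' => hmn ?_
  rw [mem_unitCube_intVec_iff] at hx hx'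
  exact hx.symm.trans hx'

theorem iUnion_unitCube : ⋃ m : ι → ℤ, unitCube (intVec m) = Set.univ := by
  ext x
  simp [mem_unitCube_intVec_iff]

theorem preimage_add_unitCube (m : ι → ℤ) :
    (fun x => x + intVec m) ⁻¹' unitCube (intVec m) = unitCube 0 := by
  ext x
  simp only [unitCube, Set.mem_preimage, Set.mem_ofPred_eq, Set.mem_Ioc, Pi.add_apply,
    Pi.zero_apply]
  refine forall_congr' fun i => ?_
  constructor <;> rintro ⟨h1, h2⟩ <;> constructor <;> linarith

/-- The sum of all integer translates of `F`. -/
noncomputable def periodization {M : Type*} [AddCommMonoid M] [TopologicalSpace M]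
    (F : (ι → ℝ) → M) (x : ι → ℝ) : M :=
  ∑' m : ι → ℤ, F (x + intVec m)

theorem periodization_add_intVec {M : Type*} [AddCommMonoid M] [TopologicalSpace M]
    (F : (ι → ℝ) → M) (x : ι → ℝ) (n : ι → ℤ) :
    periodization F (x + intVec n) = periodization F x := by
  unfold periodization
  rw [← (Equiv.addLeft n).tsum_eq (fun m => F (x + intVec m))]
  refine tsum_congr fun m => ?_
  rw [Equiv.coe_addLeft, intVec_add, add_assoc]

theorem enorm_periodization_le (φ : (ι → ℝ) → ℂ) (x : ι → ℝ) :
    ‖periodization φ x‖ₑ ≤ periodization (fun y => ‖φ y‖ₑ) x :=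
  enorm_tsum_le_tsum_enorm

noncomputable local instance : MeasureSpace UnitAddCircle := ⟨AddCircle.haarAddCircle⟩

local instance : Measure.IsAddHaarMeasure (volume : Measure UnitAddCircle) :=
  inferInstanceAs (Measure.IsAddHaarMeasure AddCircle.haarAddCircle)

local instance : IsProbabilityMeasure (volume : Measure UnitAddCircle) :=
  inferInstanceAs (IsProbabilityMeasure AddCircle.haarAddCircle)

/-- The representative in `unitCube 0` of a point of the torus `ℝⁿ / ℤⁿ`. -/
noncomputable def cubeRep (t : UnitAddTorus ι) : ι → ℝ :=
  (UnitAddTorus.measurableEquivPiIoc (0 : ι → ℝ) t).1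

theorem coe_cubeRep (t : UnitAddTorus ι) : (fun i => (cubeRep t i : UnitAddCircle)) = t :=
  (UnitAddTorus.measurableEquivPiIoc (0 : ι → ℝ)).symm_apply_apply t

section Measurability

variable [Finite ι]

theorem measurableSet_unitCube (a : ι → ℝ) : MeasurableSet (unitCube a) :=
  MeasurableSet.univ_pi' fun _ => measurableSet_Ioc

theorem measurableEmbedding_cubeRep : MeasurableEmbedding (cubeRep (ι := ι)) :=
  (MeasurableEmbedding.subtype_coe (measurableSet_unitCube 0)).comp
    (UnitAddTorus.measurableEquivPiIoc (0 : ι → ℝ)).measurableEmbedding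

theorem measurable_periodization {M : Type*} [AddCommMonoid M] [TopologicalSpace M]
    [TopologicalSpace.IsCompletelyPseudoMetrizableSpace M] [SecondCountableTopology M]
    [MeasurableSpace M] [BorelSpace M] [MeasurableAdd₂ M] {φ : (ι → ℝ) → M}
    (hφ : Measurable φ) : Measurable (periodization φ) :=
  Measurable.tsum fun _ => hφ.comp (measurable_add_const _)

end Measurability

variable [Fintype ι]

theorem measurePreserving_cubeRep :
    MeasurePreserving (cubeRep (ι := ι)) volume (volume.restrict (unitCube 0)) :=
  MeasurePreserving.comp ⟨measurable_subtype_coe, map_comap_subtype_coe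
    (measurableSet_unitCube 0) (volume : Measure (ι → ℝ))⟩
    (UnitAddTorus.measurePreserving_equivPiIoc (0 : ι → ℝ))

theorem lintegral_periodization_cubeRep {F : (ι → ℝ) → ℝ≥0∞} (hF : Measurable F) :
    ∫⁻ t, periodization F (cubeRep t) = ∫⁻ x, F x := by
  rw [measurePreserving_cubeRep.lintegral_comp_emb measurableEmbedding_cubeRep]
  unfold periodization
  have hm : ∀ m : ι → ℤ, Measurable fun x => F (x + intVec m) := fun m =>
    hF.comp (measurable_add_const _)
  rw [lintegral_tsum fun m => (hm m).aemeasurable, ← setLIntegral_univ F, ← iUnion_unitCube,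
    lintegral_iUnion (fun m => measurableSet_unitCube _) pairwise_disjoint_unitCube]
  refine tsum_congr fun m => ?_
  rw [← preimage_add_unitCube m]
  exact (measurePreserving_add_right volume (intVec m)).setLIntegral_comp_preimage
    (measurableSet_unitCube _) hF

theorem integral_periodization_cubeRep {φ : (ι → ℝ) → ℂ} (hφ : Measurable φ)
    (hi : Integrable φ) : ∫ t, periodization φ (cubeRep t) = ∫ x, φ x := by
  have hm : ∀ m : ι → ℤ, Measurable fun x => φ (x + intVec m) := fun m =>
    hφ.comp (measurable_add_const _)
  have hfin : ∑' m : ι → ℤ, ∫⁻ x in unitCube 0, ‖φ (x + intVec m)‖ₑ ≠ ⊤ := by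
    rw [← lintegral_tsum fun m => (hm m).enorm.aemeasurable]
    have := lintegral_periodization_cubeRep hφ.enorm
    rw [measurePreserving_cubeRep.lintegral_comp_emb measurableEmbedding_cubeRep] at this
    exact this.trans_ne hi.2.ne
  rw [measurePreserving_cubeRep.integral_comp measurableEmbedding_cubeRep]
  unfold periodization
  rw [integral_tsum (fun m => (hm m).aestronglyMeasurable) hfin,
    ← setIntegral_univ (f := φ), ← iUnion_unitCube,
    integral_iUnion (fun m => measurableSet_unitCube _) pairwise_disjoint_unitCube hi.integrableOn]
  refine tsum_congr fun m => ?_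
  rw [← preimage_add_unitCube m]
  exact (measurePreserving_add_right volume (intVec m)).setIntegral_preimage_emb
    (measurableEmbedding_addRight _) φ (unitCube (intVec m))

/-- Finiteness of the sum over all lattice vectors `m` of the autocorrelations
`∫ |φ(x)| |φ(x + m)| dx`, that is, square integrability over the torus of the periodization of
`|φ|`. -/
def FiniteAutocorrelation (φ : (ι → ℝ) → ℂ) : Prop :=
  ∑' m : ι → ℤ, ∫⁻ x, ‖φ x‖ₑ * ‖φ (x + intVec m)‖ₑ < ⊤

theorem lintegral_periodization_mul_periodization {F G : (ι → ℝ) → ℝ≥0∞} (hF : Measurable F)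
    (hG : Measurable G) :
    ∫⁻ t, periodization F (cubeRep t) * periodization G (cubeRep t) =
      ∑' m : ι → ℤ, ∫⁻ x, F x * G (x + intVec m) := by
  have hGp := measurable_periodization hG
  calc ∫⁻ t, periodization F (cubeRep t) * periodization G (cubeRep t)
      = ∫⁻ t, periodization (fun x => F x * periodization G x) (cubeRep t) := by
        refine lintegral_congr fun t => ?_
        simp only [periodization.eq_1 (fun x => F x * periodization G x),
          periodization_add_intVec, ENNReal.tsum_mul_right, periodization.eq_1 F]
    _ = ∫⁻ x, F x * periodization G x := lintegral_periodization_cubeRep (hF.mul hGp)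
    _ = ∑' m : ι → ℤ, ∫⁻ x, F x * G (x + intVec m) := by
        simp only [periodization, ← ENNReal.tsum_mul_left]
        exact lintegral_tsum fun m => (hF.mul (hG.comp (measurable_add_const _))).aemeasurable

namespace FiniteAutocorrelation

variable {φ ψ : (ι → ℝ) → ℂ}

theorem lintegral_periodization_sq_lt_top (h : FiniteAutocorrelation φ) (hφ : Measurable φ) :
    ∫⁻ t, periodization (fun x => ‖φ x‖ₑ) (cubeRep t) ^ 2 < ⊤ := by
  simp only [sq]
  rwa [lintegral_periodization_mul_periodization hφ.enorm hφ.enorm]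

theorem tsum_lintegral_mul_lt_top (h : FiniteAutocorrelation φ) (h' : FiniteAutocorrelation ψ)
    (hφ : Measurable φ) (hψ : Measurable ψ) :
    ∑' m : ι → ℤ, ∫⁻ x, ‖φ x‖ₑ * ‖ψ (x + intVec m)‖ₑ < ⊤ := by
  rw [← lintegral_periodization_mul_periodization hφ.enorm hψ.enorm]
  refine (lintegral_mono fun t => ennreal_mul_le_sq_add_sq _ _).trans_lt ?_
  have hm : Measurable fun t : UnitAddTorus ι => periodization (fun x => ‖φ x‖ₑ) (cubeRep t) ^ 2 :=
    ((measurable_periodization hφ.enorm).comp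
      measurableEmbedding_cubeRep.measurable).pow_const 2
  rw [lintegral_add_left hm]
  exact ENNReal.add_lt_top.2
    ⟨h.lintegral_periodization_sq_lt_top hφ, h'.lintegral_periodization_sq_lt_top hψ⟩

theorem integrable (h : FiniteAutocorrelation φ) (hφ : Measurable φ) : Integrable φ := by
  refine ⟨hφ.aestronglyMeasurable, ?_⟩
  rw [hasFiniteIntegral_iff_enorm, ← lintegral_periodization_cubeRep hφ.enorm]
  refine (lintegral_mono fun t =>
    (mul_one _).symm.le.trans (ennreal_mul_le_sq_add_sq _ 1)).trans_lt ?_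
  rw [lintegral_add_right _ measurable_const]
  exact ENNReal.add_lt_top.2 ⟨h.lintegral_periodization_sq_lt_top hφ, by simp⟩

theorem memLp_periodization (h : FiniteAutocorrelation φ) (hφ : Measurable φ) :
    MemLp (fun t => periodization φ (cubeRep t)) 2 (volume : Measure (UnitAddTorus ι)) := by
  refine ⟨((measurable_periodization hφ).comp
    measurableEmbedding_cubeRep.measurable).aestronglyMeasurable, ?_⟩
  rw [eLpNorm_lt_top_iff_lintegral_rpow_enorm_lt_top (by norm_num) (by norm_num)]
  simp only [ENNReal.toReal_ofNat, ENNReal.rpow_ofNat]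
  refine lt_of_le_of_lt (lintegral_mono fun t => ?_) (h.lintegral_periodization_sq_lt_top hφ)
  gcongr
  exact enorm_periodization_le φ _

theorem integral_periodization_mul_conj (h : FiniteAutocorrelation φ)
    (h' : FiniteAutocorrelation ψ) (hφ : Measurable φ) (hψ : Measurable ψ) :
    ∫ t, periodization φ (cubeRep t) * conj (periodization ψ (cubeRep t)) =
      ∑' m : ι → ℤ, ∫ x, φ x * conj (ψ (x + intVec m)) := by
  have hterm : ∀ m : ι → ℤ, Measurable fun x => φ x * conj (ψ (x + intVec m)) := fun m =>
    hφ.mul (Complex.continuous_conj.measurable.comp (hψ.comp (measurable_add_const _)))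
  have hfin : ∑' m : ι → ℤ, ∫⁻ x, ‖φ x * conj (ψ (x + intVec m))‖ₑ < ⊤ := by
    simpa only [enorm_mul, RCLike.enorm_conj] using h.tsum_lintegral_mul_lt_top h' hφ hψ
  have hmeas : Measurable fun x => φ x * conj (periodization ψ x) :=
    hφ.mul (Complex.continuous_conj.measurable.comp (measurable_periodization hψ))
  have hint : Integrable fun x => φ x * conj (periodization ψ x) := by
    refine ⟨hmeas.aestronglyMeasurable, lt_of_le_of_lt ?_ hfin⟩
    rw [← lintegral_tsum fun m => (hterm m).enorm.aemeasurable]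
    refine lintegral_mono fun x => ?_
    simp only [enorm_mul, ENNReal.tsum_mul_left, RCLike.enorm_conj]
    gcongr
    exact enorm_periodization_le ψ x
  calc ∫ t, periodization φ (cubeRep t) * conj (periodization ψ (cubeRep t))
      = ∫ t, periodization (fun x => φ x * conj (periodization ψ x)) (cubeRep t) := by
        refine integral_congr_ae (Filter.Eventually.of_forall fun t => ?_)
        simp only [periodization.eq_1 (fun x => φ x * conj (periodization ψ x)),
          periodization_add_intVec, tsum_mul_right, periodization.eq_1 φ]
    _ = ∫ x, φ x * conj (periodization ψ x) := integral_periodization_cubeRep hmeas hint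
    _ = ∑' m : ι → ℤ, ∫ x, φ x * conj (ψ (x + intVec m)) := by
        rw [← integral_tsum (fun m => (hterm m).aestronglyMeasurable) hfin.ne]
        simp only [periodization, Complex.conj_tsum, tsum_mul_left]

end FiniteAutocorrelation

theorem mFourier_coe (n : ι → ℤ) (x : ι → ℝ) :
    UnitAddTorus.mFourier n (fun i => (x i : UnitAddCircle)) = (𝐞 (intVec n ⬝ᵥ x) : ℂ) := by
  simp only [UnitAddTorus.mFourier, ContinuousMap.coe_mk, fourier_coe_apply,
    Real.fourierChar_apply, ← Complex.exp_sum]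
  congr 1
  simp only [dotProduct, intVec]
  push_cast
  rw [Finset.mul_sum, Finset.sum_mul]
  refine Finset.sum_congr rfl fun i _ => ?_
  ring

theorem fourierChar_intVec_dotProduct_add_intVec (n m : ι → ℤ) (x : ι → ℝ) :
    𝐞 (intVec n ⬝ᵥ (x + intVec m)) = 𝐞 (intVec n ⬝ᵥ x) := by
  refine Circle.ext ?_
  rw [← mFourier_coe, ← mFourier_coe]
  congr 1
  ext i
  simp [intVec]

theorem mFourierCoeff_periodization {φ : (ι → ℝ) → ℂ} (hφ : Measurable φ) (hi : Integrable φ)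
    (k : ι → ℤ) :
    UnitAddTorus.mFourierCoeff (fun t => periodization φ (cubeRep t)) (-k) =
      ∫ x, φ x * 𝐞 (intVec k ⬝ᵥ x) := by
  have hcont : Continuous fun x : ι → ℝ => (𝐞 (intVec k ⬝ᵥ x) : ℂ) := by fun_prop
  have hint : Integrable fun x => φ x * 𝐞 (intVec k ⬝ᵥ x) :=
    hi.mul_bdd (c := 1) hcont.aestronglyMeasurable
      (Filter.Eventually.of_forall fun x => (Circle.norm_coe _).le)
  have hmeas : Measurable fun x => φ x * (𝐞 (intVec k ⬝ᵥ x) : ℂ) := hφ.mul hcont.measurable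
  rw [← integral_periodization_cubeRep hmeas hint]
  refine integral_congr_ae (Filter.Eventually.of_forall fun t => ?_)
  have hchar : UnitAddTorus.mFourier k t = 𝐞 (intVec k ⬝ᵥ cubeRep t) := by
    rw [← mFourier_coe, coe_cubeRep]
  simp only [neg_neg, hchar, smul_eq_mul, periodization, fourierChar_intVec_dotProduct_add_intVec,
    tsum_mul_right]
  exact mul_comm _ _

/-- Parseval's identity on the torus, applied to the periodizations of `φ` and `ψ`. -/
theorem FiniteAutocorrelation.hasSum_integral_fourierChar_mul_conj {φ ψ : (ι → ℝ) → ℂ}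
    (h : FiniteAutocorrelation φ) (h' : FiniteAutocorrelation ψ) (hφ : Measurable φ)
    (hψ : Measurable ψ) :
    HasSum (fun k : ι → ℤ =>
        (∫ x, φ x * 𝐞 (intVec k ⬝ᵥ x)) * conj (∫ x, ψ x * 𝐞 (intVec k ⬝ᵥ x)))
      (∑' m : ι → ℤ, ∫ x, φ x * conj (ψ (x + intVec m))) := by
  have hφ2 := h.memLp_periodization hφ
  have hψ2 := h'.memLp_periodization hψ
  have hcoeff : ∀ {χ : (ι → ℝ) → ℂ} (hχ : MemLp (fun t => periodization χ (cubeRep t)) 2)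
      (n : ι → ℤ), UnitAddTorus.mFourierCoeff (hχ.toLp _) n =
        UnitAddTorus.mFourierCoeff (fun t => periodization χ (cubeRep t)) n := fun hχ n =>
    integral_congr_ae (hχ.coeFn_toLp.mono fun t ht => by simp only [ht])
  have hint : ∫ t, conj (hψ2.toLp _ t) * hφ2.toLp _ t =
      ∫ t, periodization φ (cubeRep t) * conj (periodization ψ (cubeRep t)) := by
    refine integral_congr_ae ?_
    filter_upwards [hψ2.coeFn_toLp, hφ2.coeFn_toLp] with t ht ht'
    rw [ht, ht', mul_comm]
  have hParseval := (Equiv.neg (ι → ℤ)).hasSum_iff.2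
    (UnitAddTorus.hasSum_prod_mFourierCoeff (hψ2.toLp _) (hφ2.toLp _))
  rw [hint, h.integral_periodization_mul_conj h' hφ hψ] at hParseval
  refine hParseval.congr_fun fun k => ?_
  simp only [Function.comp_apply, Equiv.neg_apply, hcoeff,
    mFourierCoeff_periodization hφ (h.integrable hφ),
    mFourierCoeff_periodization hψ (h'.integrable hψ), mul_comm]

end Torus

/-! ### Fourier multipliers -/

section Multiplier

variable {d : ℕ}

/-- The Fourier multiplier with essentially bounded symbol `s`, as a bounded operator. -/
noncomputable def fourierMultiplierOp {s : EuclideanSpace ℝ (Fin d) → ℂ} (hs : MemLp s ∞ volume) :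
    L2Space d →L[ℂ] L2Space d :=
  fourierInvCLM ℂ (L2Space d) ∘L
    (ContinuousLinearMap.mul ℂ ℂ).holderL volume ∞ 2 2 (hs.toLp s) ∘L fourierCLM ℂ (L2Space d)

theorem isFourierMultiplier_fourierMultiplierOp {s : EuclideanSpace ℝ (Fin d) → ℂ}
    (hs : MemLp s ∞ volume) : IsFourierMultiplier (fourierMultiplierOp hs) s := by
  refine ⟨hs, fun f => ?_⟩
  have hop : 𝓕 (fourierMultiplierOp hs f) =
      (ContinuousLinearMap.mul ℂ ℂ).holder 2 (hs.toLp s) (𝓕 f : L2Space d) :=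
    FourierTransform.fourier_fourierInv_eq _
  rw [hop]
  filter_upwards [(ContinuousLinearMap.mul ℂ ℂ).coeFn_holder (r := 2) (hs.toLp s)
    (𝓕 f : L2Space d), hs.coeFn_toLp] with ξ hξ hs'
  rw [hξ, hs', ContinuousLinearMap.mul_apply']

theorem fourier_injective : Function.Injective (𝓕 : L2Space d → L2Space d) :=
  (Lp.fourierTransformₗᵢ (EuclideanSpace ℝ (Fin d)) ℂ).injective

theorem IsFourierMultiplier.commute {Θ Ψ : L2Space d →L[ℂ] L2Space d}
    {s t : EuclideanSpace ℝ (Fin d) → ℂ} (hΘ : IsFourierMultiplier Θ s)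
    (hΨ : IsFourierMultiplier Ψ t) : Commute Θ Ψ := by
  refine ContinuousLinearMap.ext fun f => fourier_injective (Lp.ext ?_)
  filter_upwards [hΘ.2 (Ψ f), hΨ.2 f, hΨ.2 (Θ f), hΘ.2 f] with ξ h₁ h₂ h₃ h₄
  simp only [ContinuousLinearMap.mul_def, ContinuousLinearMap.comp_apply, h₁, h₂, h₃, h₄]
  ring

theorem translationOp_toLp (β : EuclideanSpace ℝ (Fin d))
    (φ : SchwartzMap (EuclideanSpace ℝ (Fin d)) ℂ) :
    translationOp β (φ.toLp 2) = (φ.compSubConstCLM ℂ β).toLp 2 := by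
  have hmp := measurePreserving_sub_right (volume : Measure (EuclideanSpace ℝ (Fin d))) β
  refine Lp.ext ((Lp.coeFn_compMeasurePreserving _ hmp).trans
    ((hmp.quasiMeasurePreserving.ae_eq_comp (φ.coeFn_toLp 2 volume)).trans ?_))
  exact ((φ.compSubConstCLM ℂ β).coeFn_toLp 2 volume).symm

theorem fourier_compSubConstCLM (β : EuclideanSpace ℝ (Fin d))
    (φ : SchwartzMap (EuclideanSpace ℝ (Fin d)) ℂ) (ξ : EuclideanSpace ℝ (Fin d)) :
    𝓕 (φ.compSubConstCLM ℂ β) ξ = 𝐞 (-inner ℝ β ξ) * 𝓕 φ ξ := by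
  have h := congrFun (VectorFourier.fourierIntegral_comp_add_right 𝐞 volume
    (innerₗ (EuclideanSpace ℝ (Fin d))) φ (-β)) ξ
  rw [SchwartzMap.fourier_coe, SchwartzMap.fourier_coe]
  simp only [innerₗ_apply_apply, inner_neg_left, Circle.smul_def, smul_eq_mul] at h
  have hcomp : (φ.compSubConstCLM ℂ β : EuclideanSpace ℝ (Fin d) → ℂ) =
      φ ∘ fun x => x + -β := by
    ext x
    simp [sub_eq_add_neg]
  rw [hcomp]
  exact h

theorem memLp_top_fourierChar_neg_inner (β : EuclideanSpace ℝ (Fin d)) :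
    MemLp (fun ξ => (𝐞 (-inner ℝ β ξ) : ℂ)) ∞ (volume : Measure (EuclideanSpace ℝ (Fin d))) := by
  have hcont : Continuous fun ξ : EuclideanSpace ℝ (Fin d) => (𝐞 (-inner ℝ β ξ) : ℂ) := by fun_prop
  exact memLp_top_of_bound hcont.aestronglyMeasurable 1 (.of_forall fun ξ => (Circle.norm_coe _).le)

theorem isFourierMultiplier_translationOp (β : EuclideanSpace ℝ (Fin d)) :
    IsFourierMultiplier (translationOp β) fun ξ => 𝐞 (-inner ℝ β ξ) := by
  have hs := memLp_top_fourierChar_neg_inner β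
  have hop : translationOp β = fourierMultiplierOp hs := by
    refine DFunLike.coe_injective ((SchwartzMap.denseRange_toLpCLM (F := ℂ) (p := 2)
      (μ := volume) ENNReal.ofNat_ne_top).equalizer (translationOp β).continuous
      (fourierMultiplierOp hs).continuous (funext fun φ => fourier_injective (Lp.ext ?_)))
    simp only [Function.comp_apply, SchwartzMap.toLpCLM_apply, translationOp_toLp,
      SchwartzMap.toLp_fourier_eq]
    filter_upwards [(isFourierMultiplier_fourierMultiplierOp hs).2 (φ.toLp 2),
      (𝓕 φ).coeFn_toLp 2 volume, (𝓕 (φ.compSubConstCLM ℂ β)).coeFn_toLp 2 volume]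
      with ξ h₁ h₂ h₃
    rw [h₁, h₃, SchwartzMap.toLp_fourier_eq, h₂, fourier_compSubConstCLM]
  rw [hop]
  exact isFourierMultiplier_fourierMultiplierOp hs

theorem fourier_translationOp (β : EuclideanSpace ℝ (Fin d)) (f : L2Space d) :
    (𝓕 (translationOp β f) : L2Space d) =ᵐ[volume]
      fun ξ => 𝐞 (-inner ℝ β ξ) * (𝓕 f : L2Space d) ξ :=
  (isFourierMultiplier_translationOp β).2 f

theorem inner_translationOp (β : EuclideanSpace ℝ (Fin d)) (h f : L2Space d) :
    (inner ℂ (translationOp β h) f : ℂ) =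
      ∫ ξ, (𝓕 f : L2Space d) ξ * conj ((𝓕 h : L2Space d) ξ) * 𝐞 (inner ℝ β ξ) := by
  rw [← Lp.inner_fourier_eq, L2.inner_def]
  refine integral_congr_ae ?_
  filter_upwards [fourier_translationOp β h] with ξ hξ
  rw [hξ, RCLike.inner_apply, map_mul, AddChar.map_neg_eq_inv, Circle.coe_inv_eq_conj,
    Complex.conj_conj]
  ring

theorem inner_translationOp_translationOp (β : EuclideanSpace ℝ (Fin d)) (f₁ f₂ : L2Space d) :
    (inner ℂ (translationOp β f₁) (translationOp β f₂) : ℂ) = inner ℂ f₁ f₂ :=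
  (Lp.compMeasurePreservingₗᵢ ℂ (fun x => x - β)
    (measurePreserving_sub_right volume β)).inner_map_map f₁ f₂

end Multiplier

section Lattice

variable {d : ℕ} (C : Matrix (Fin d) (Fin d) ℝ)

theorem latticePoint_neg (k : Fin d → ℤ) : latticePoint C (-k) = -latticePoint C k := by
  ext i
  simp [latticePoint, Matrix.mulVec, dotProduct]

/-- The linear parametrization of `ℝᵈ` that takes `ℤᵈ` to the dual lattice of `C ℤᵈ`. -/
noncomputable def dualParam (η : Fin d → ℝ) : EuclideanSpace ℝ (Fin d) :=
  WithLp.toLp 2 ((dualMatrix C).mulVec η)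

theorem measurable_dualParam : Measurable (dualParam C) :=
  (WithLp.measurable_toLp 2 (Fin d → ℝ)).comp
    ((dualMatrix C).mulVecLin.continuous_of_finiteDimensional).measurable

theorem dualParam_add_intVec (η : Fin d → ℝ) (l : Fin d → ℤ) :
    dualParam C (η + intVec l) = dualParam C η + latticePoint (dualMatrix C) l := by
  simp only [dualParam, Matrix.mulVec_add, WithLp.toLp_add]
  rfl

variable {C}

theorem transpose_mulVec_latticePoint_dualMatrix (hC : IsUnit C) (l : Fin d → ℤ) :
    C.transpose.mulVec (latticePoint (dualMatrix C) l) = intVec l := by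
  have hdet : IsUnit C.transpose.det := Matrix.isUnit_det_transpose _
    ((Matrix.isUnit_iff_isUnit_det C).1 hC)
  simp only [latticePoint, dualMatrix]
  rw [Matrix.mulVec_mulVec, Matrix.mul_nonsing_inv _ hdet, Matrix.one_mulVec]
  rfl

theorem inner_latticePoint_dualParam (hC : IsUnit C) (k : Fin d → ℤ) (η : Fin d → ℝ) :
    inner ℝ (latticePoint C k) (dualParam C η) = intVec k ⬝ᵥ η := by
  have hdet : IsUnit C.det := (Matrix.isUnit_iff_isUnit_det C).1 hC
  rw [EuclideanSpace.inner_eq_star_dotProduct]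
  simp only [latticePoint, dualParam, star_trivial, dualMatrix]
  rw [← Matrix.vecMul_transpose, ← Matrix.dotProduct_mulVec, Matrix.mulVec_mulVec,
    Matrix.transpose_nonsing_inv, Matrix.transpose_transpose, Matrix.nonsing_inv_mul _ hdet,
    Matrix.one_mulVec, dotProduct_comm]
  rfl

theorem map_dualParam (hC : IsUnit C) :
    (volume : Measure (Fin d → ℝ)).map (dualParam C) = ENNReal.ofReal |C.det| • volume := by
  have hdet : C.det ≠ 0 := ((Matrix.isUnit_iff_isUnit_det C).1 hC).ne_zero
  have hdual : (dualMatrix C).det = C.det⁻¹ := by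
    rw [dualMatrix, Matrix.det_nonsing_inv, Matrix.det_transpose, Ring.inverse_eq_inv']
  have hcomp : dualParam C = WithLp.toLp 2 ∘ Matrix.toLin' (dualMatrix C) := rfl
  rw [hcomp, ← Measure.map_map (WithLp.measurable_toLp 2 (Fin d → ℝ))
    (Matrix.toLin' (dualMatrix C)).continuous_of_finiteDimensional.measurable,
    Real.map_matrix_volume_pi_eq_smul_volume_pi (hdual ▸ inv_ne_zero hdet),
    Measure.map_smul, hdual, inv_inv, (PiLp.volume_preserving_toLp (Fin d)).map_eq]

theorem lintegral_comp_dualParam (hC : IsUnit C) {F : EuclideanSpace ℝ (Fin d) → ℝ≥0∞}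
    (hF : Measurable F) :
    ∫⁻ η, F (dualParam C η) = ENNReal.ofReal |C.det| * ∫⁻ ξ, F ξ := by
  rw [← lintegral_map hF (measurable_dualParam C), map_dualParam hC, lintegral_smul_measure,
    smul_eq_mul]

theorem integral_comp_dualParam (hC : IsUnit C) {F : EuclideanSpace ℝ (Fin d) → ℂ}
    (hF : Measurable F) :
    ∫ η, F (dualParam C η) = (|C.det| : ℝ) * ∫ ξ, F ξ := by
  rw [← integral_map (measurable_dualParam C).aemeasurable hF.aestronglyMeasurable,
    map_dualParam hC, integral_smul_measure, ENNReal.toReal_ofReal (abs_nonneg _),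
    Complex.real_smul]

theorem finiteAutocorrelation_comp_dualParam (hC : IsUnit C)
    {Φ : EuclideanSpace ℝ (Fin d) → ℂ} (hΦ : Measurable Φ)
    (h : ∑' l : Fin d → ℤ, ∫⁻ ξ, ‖Φ ξ‖ₑ * ‖Φ (ξ + latticePoint (dualMatrix C) l)‖ₑ < ⊤) :
    FiniteAutocorrelation (Φ ∘ dualParam C) := by
  have hpull : ∀ l : Fin d → ℤ,
      ∫⁻ η, ‖Φ (dualParam C η)‖ₑ * ‖Φ (dualParam C η + latticePoint (dualMatrix C) l)‖ₑ =
      ENNReal.ofReal |C.det| * ∫⁻ ξ, ‖Φ ξ‖ₑ * ‖Φ (ξ + latticePoint (dualMatrix C) l)‖ₑ := fun l =>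
    lintegral_comp_dualParam hC (hΦ.enorm.mul (hΦ.comp (measurable_add_const _)).enorm)
  simp only [FiniteAutocorrelation, Function.comp_apply, dualParam_add_intVec, hpull,
    ENNReal.tsum_mul_left]
  exact ENNReal.mul_lt_top ENNReal.ofReal_lt_top h

theorem hasSum_integral_fourierChar_latticePoint_mul_conj (hC : IsUnit C)
    {Φ Ψ : EuclideanSpace ℝ (Fin d) → ℂ} (hΦ : Measurable Φ) (hΨ : Measurable Ψ)
    (hΦΦ : FiniteAutocorrelation (Φ ∘ dualParam C))
    (hΨΨ : FiniteAutocorrelation (Ψ ∘ dualParam C)) :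
    HasSum (fun k : Fin d → ℤ =>
        (∫ ξ, Φ ξ * 𝐞 (inner ℝ (latticePoint C k) ξ)) *
          conj (∫ ξ, Ψ ξ * 𝐞 (inner ℝ (latticePoint C k) ξ)))
      (((|C.det|⁻¹ : ℝ) : ℂ) *
        ∑' l : Fin d → ℤ, ∫ ξ, Φ ξ * conj (Ψ (ξ + latticePoint (dualMatrix C) l))) := by
  have hdet : ((|C.det| : ℝ) : ℂ) ≠ 0 :=
    Complex.ofReal_ne_zero.2 (abs_ne_zero.2 ((Matrix.isUnit_iff_isUnit_det C).1 hC).ne_zero)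
  have hcoeff : ∀ {χ : EuclideanSpace ℝ (Fin d) → ℂ}, Measurable χ → ∀ k : Fin d → ℤ,
      ∫ η, (χ ∘ dualParam C) η * 𝐞 (intVec k ⬝ᵥ η) =
      (|C.det| : ℝ) * ∫ ξ, χ ξ * 𝐞 (inner ℝ (latticePoint C k) ξ) := by
    intro χ hχ k
    have hchar : Measurable fun ξ => (𝐞 (inner ℝ (latticePoint C k) ξ) : ℂ) :=
      Continuous.measurable (by fun_prop)
    simp only [← inner_latticePoint_dualParam hC, Function.comp_apply]
    exact integral_comp_dualParam hC (hχ.mul hchar)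
  have hcorr : ∀ l : Fin d → ℤ,
      ∫ η, (Φ ∘ dualParam C) η * conj ((Ψ ∘ dualParam C) (η + intVec l)) =
      (|C.det| : ℝ) * ∫ ξ, Φ ξ * conj (Ψ (ξ + latticePoint (dualMatrix C) l)) := by
    intro l
    simp only [Function.comp_apply, dualParam_add_intVec]
    exact integral_comp_dualParam hC (hΦ.mul
      (Complex.continuous_conj.measurable.comp (hΨ.comp (measurable_add_const _))))
  have hParseval := (hΦΦ.hasSum_integral_fourierChar_mul_conj hΨΨ
    (hΦ.comp (measurable_dualParam C)) (hΨ.comp (measurable_dualParam C))).mul_left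
      (((|C.det| : ℝ) : ℂ)⁻¹ ^ 2)
  have hcancel : ∀ z w : ℂ, ((|C.det| : ℝ) : ℂ)⁻¹ ^ 2 *
      ((|C.det| : ℝ) * z * ((|C.det| : ℝ) * w)) = z * w := fun z w => by field_simp
  have hcancel' : ∀ z : ℂ, ((|C.det| : ℝ) : ℂ)⁻¹ ^ 2 * ((|C.det| : ℝ) * z) =
      ((|C.det| : ℝ) : ℂ)⁻¹ * z := fun z => by field_simp
  simpa only [hcoeff hΦ, hcoeff hΨ, hcorr, map_mul, Complex.conj_ofReal, tsum_mul_left, hcancel,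
    hcancel', Complex.ofReal_inv] using hParseval

end Lattice

/-! ### Bohr means of trigonometric series -/

section BohrMean

open ProbabilityTheory Filter

variable {V : Type*} [NormedAddCommGroup V] [InnerProductSpace ℝ V] [FiniteDimensional ℝ V]
  [MeasurableSpace V] [BorelSpace V]

theorem integral_fourierChar_inner_stdGaussian (w : V) :
    ∫ x, (𝐞 (inner ℝ w x) : ℂ) ∂stdGaussian V =
      Real.exp (-(2 * Real.pi ^ 2 * ‖w‖ ^ 2)) := by
  have hchar : ∀ x, (𝐞 (inner ℝ w x) : ℂ) =
      Complex.exp ((inner ℝ x ((2 * Real.pi) • w) : ℝ) * Complex.I) := fun x => by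
    rw [Real.fourierChar_apply, real_inner_smul_right, real_inner_comm]
  simp only [hchar]
  rw [← charFun_apply, charFun_stdGaussian, norm_smul, Real.norm_of_nonneg Real.two_pi_pos.le,
    Complex.ofReal_exp]
  congr 1
  push_cast
  ring

open Classical in
theorem tendsto_integral_fourierChar_stdGaussian (w : V) :
    Tendsto (fun R : ℝ => ∫ x, (𝐞 (inner ℝ w (R • x)) : ℂ) ∂stdGaussian V) atTop
      (𝓝 (if w = 0 then 1 else 0)) := by
  simp only [real_inner_smul_right, ← real_inner_smul_left,
    integral_fourierChar_inner_stdGaussian]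
  split_ifs with hw
  · simp [hw]
  · have hdecay : Tendsto (fun R : ℝ => 2 * Real.pi ^ 2 * ‖R • w‖ ^ 2) atTop atTop := by
      simp only [norm_smul, mul_pow, Real.norm_eq_abs, sq_abs]
      exact ((tendsto_pow_atTop two_ne_zero).atTop_mul_const (by positivity)).const_mul_atTop
        (by positivity)
    exact_mod_cast (Complex.continuous_ofReal.tendsto 0).comp
      (Real.tendsto_exp_neg_atTop_nhds_zero.comp hdecay)

variable {ι : Type*} [Countable ι] {c : ι → ℂ}

theorem tendsto_integral_tsum_mul_fourierChar_stdGaussian (hc : Summable c) (β : ι → V) (α : V) :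
    Tendsto (fun R : ℝ => ∫ x, (∑' j, c j * 𝐞 (inner ℝ (β j) (R • x))) *
        𝐞 (-inner ℝ α (R • x)) ∂stdGaussian V) atTop
      (𝓝 (∑' j : β ⁻¹' {α}, c j)) := by
  classical
  have hterm : ∀ (R : ℝ), ∫ x, (∑' j, c j * 𝐞 (inner ℝ (β j) (R • x))) *
        𝐞 (-inner ℝ α (R • x)) ∂stdGaussian V =
      ∑' j, c j * ∫ x, (𝐞 (inner ℝ (β j - α) (R • x)) : ℂ) ∂stdGaussian V := by
    intro R
    have hint : ∀ w : V, Integrable (fun x => (𝐞 (inner ℝ w (R • x)) : ℂ)) (stdGaussian V) :=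
      fun w => (integrable_const (1 : ℝ)).mono'
        (Continuous.aestronglyMeasurable (by fun_prop)) (.of_forall fun x => (Circle.norm_coe _).le)
    simp only [← tsum_mul_right, mul_assoc, ← Circle.coe_mul, ← AddChar.map_add_eq_mul,
      ← sub_eq_add_neg, ← inner_sub_left, ← integral_const_mul]
    refine (integral_tsum_of_summable_integral_norm (fun j => (hint _).const_mul _) ?_).symm
    simpa only [norm_mul, Circle.norm_coe, mul_one, integral_const, probReal_univ, one_smul]
      using hc.norm
  have hlim : ∑' j : β ⁻¹' {α}, c j = ∑' j, c j * if β j - α = 0 then 1 else 0 := by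
    rw [tsum_subtype]
    simp only [mul_ite, mul_one, mul_zero, sub_eq_zero]
    rfl
  simp only [hterm, hlim]
  refine tendsto_tsum_of_dominated_convergence hc.norm
    (fun j => (tendsto_integral_fourierChar_stdGaussian _).const_mul _) (.of_forall fun R j => ?_)
  rw [norm_mul]
  refine mul_le_of_le_one_right (norm_nonneg _) ((norm_integral_le_integral_norm _).trans ?_)
  simp only [Circle.norm_coe, integral_const, probReal_univ, one_smul, le_refl]

theorem tsum_fiber_eq_zero_of_tsum_mul_fourierChar_eq_const (hc : Summable c) {β : ι → V} {a : ℂ}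
    (h : ∀ x, ∑' j, c j * 𝐞 (inner ℝ (β j) x) = a) {α : V} (hα : α ≠ 0) :
    ∑' j : β ⁻¹' {α}, c j = 0 := by
  have hseries := tendsto_integral_tsum_mul_fourierChar_stdGaussian hc β α
  have hconst := tendsto_integral_tsum_mul_fourierChar_stdGaussian (c := fun _ : Unit => a)
    (hasSum_fintype _).summable (fun _ => (0 : V)) α
  have hempty : IsEmpty ((fun _ : Unit => (0 : V)) ⁻¹' {α}) := ⟨fun j => hα j.2.symm⟩
  simp only [h] at hseries
  simp only [inner_zero_left, AddChar.map_zero_eq_one, Circle.coe_one, mul_one, tsum_fintype,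
    Finset.univ_unique, Finset.sum_singleton, tsum_empty] at hconst
  exact tendsto_nhds_unique hseries hconst

end BohrMean

theorem tsum_eq_tsum_fiber {ι κ : Type*} {c : ι → ℂ} (hc : Summable c)
    {β : ι → κ} {α₀ : κ}
    (h : ∀ α ≠ α₀, ∑' j : β ⁻¹' {α}, c j = 0) : ∑' j, c j = ∑' j : β ⁻¹' {α₀}, c j := by
  rw [← (hc.hasSum.tsum_fiberwise β).tsum_eq]
  exact tsum_eq_single α₀ h

/-! ### Dual frequencies and cross sums -/

section DualFrequencies

variable {d : ℕ} {P : Type*} {C : P → Matrix (Fin d) (Fin d) ℝ}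

/-- The frequency `C_p' l` attached to the pair `(p, l)`. -/
noncomputable def dualFrequency (C : P → Matrix (Fin d) (Fin d) ℝ) (pl : P × (Fin d → ℤ)) :
    EuclideanSpace ℝ (Fin d) :=
  latticePoint (dualMatrix (C pl.1)) pl.2

theorem dualFrequency_eq_iff (hC : ∀ p, IsUnit (C p)) {pl : P × (Fin d → ℤ)}
    {α : EuclideanSpace ℝ (Fin d)} :
    dualFrequency C pl = α ↔ (C pl.1).transpose.mulVec α = intVec pl.2 := by
  constructor
  · rintro rfl
    exact transpose_mulVec_latticePoint_dualMatrix (hC pl.1) pl.2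
  · intro hα
    have hdet : IsUnit (C pl.1).transpose.det := Matrix.isUnit_det_transpose _
      ((Matrix.isUnit_iff_isUnit_det _).1 (hC pl.1))
    change WithLp.toLp 2 ((C pl.1).transpose⁻¹.mulVec (intVec pl.2)) = α
    rw [← hα, Matrix.mulVec_mulVec, Matrix.nonsing_inv_mul _ hdet, Matrix.one_mulVec]

theorem intVec_injective {ι : Type*} : Function.Injective (intVec (ι := ι)) := fun _ _ h =>
  funext fun i => Int.cast_injective (congrFun h i)

/-- The pairs `(p, l)` with `C_p' l = α` correspond to the indices in `P_α`. -/
noncomputable def fiberEquiv (hC : ∀ p, IsUnit (C p)) (α : EuclideanSpace ℝ (Fin d)) :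
    dualFrequency C ⁻¹' {α} ≃ activeIndices C α :=
  Equiv.ofBijective (fun pl => ⟨pl.1.1, pl.1.2, (dualFrequency_eq_iff hC).1 pl.2⟩) <| by
    constructor
    · rintro ⟨⟨p, l⟩, hl⟩ ⟨⟨q, m⟩, hm⟩ hpq
      obtain rfl : p = q := congrArg Subtype.val hpq
      obtain rfl : l = m := intVec_injective
        (((dualFrequency_eq_iff hC).1 hl).symm.trans ((dualFrequency_eq_iff hC).1 hm))
      rfl
    · rintro ⟨p, l, hl⟩
      exact ⟨⟨(p, l), (dualFrequency_eq_iff hC).2 hl⟩, rfl⟩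

theorem tsum_dualFrequency_fiber {M : Type*} [AddCommMonoid M] [TopologicalSpace M]
    (hC : ∀ p, IsUnit (C p)) (F : EuclideanSpace ℝ (Fin d) → P → M)
    (α : EuclideanSpace ℝ (Fin d)) :
    ∑' pl : dualFrequency C ⁻¹' {α}, F (dualFrequency C pl) pl.1.1 =
      ∑' p : activeIndices C α, F α p := by
  rw [← (fiberEquiv hC α).tsum_eq]
  refine tsum_congr fun pl => ?_
  rw [pl.2]
  rfl

theorem tsum_activeIndices_le (hC : ∀ p, IsUnit (C p))
    (F : EuclideanSpace ℝ (Fin d) → P → ℝ≥0∞) (α : EuclideanSpace ℝ (Fin d)) :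
    ∑' p : activeIndices C α, F α p ≤ ∑' pl, F (dualFrequency C pl) pl.1 :=
  (tsum_dualFrequency_fiber hC F α).symm.trans_le
    (ENNReal.tsum_comp_le_tsum_of_injective Subtype.val_injective _)

theorem isEmpty_activeIndices (hC : ∀ p, IsUnit (C p)) {α : EuclideanSpace ℝ (Fin d)}
    (hα : α ∉ frequencySet C) : IsEmpty (activeIndices C α) :=
  ⟨fun p => hα (Set.mem_iUnion.2 ⟨p, p.2.choose,
    (dualFrequency_eq_iff (pl := (p.1, p.2.choose)) hC).2 p.2.choose_spec⟩)⟩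

theorem activeIndices_zero (C : P → Matrix (Fin d) (Fin d) ℝ) :
    activeIndices C 0 = Set.univ :=
  Set.eq_univ_of_forall fun p => ⟨0, by ext i; simp⟩

end DualFrequencies

section CrossSum

variable {d : ℕ} {P : Type*} {C : P → Matrix (Fin d) (Fin d) ℝ} {g h : P → L2Space d}

theorem measurable_coeFn (f : L2Space d) : Measurable (f : EuclideanSpace ℝ (Fin d) → ℂ) :=
  (Lp.stronglyMeasurable f).measurable

/-- The cross-spectrum `𝓕 f(ξ) conj(𝓕 u(ξ + α))` of `f` and `u` with frequency offset `α`. -/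
noncomputable def crossSpectrum (f u : L2Space d) (α ξ : EuclideanSpace ℝ (Fin d)) : ℂ :=
  (𝓕 f : L2Space d) ξ * conj ((𝓕 u : L2Space d) (ξ + α))

theorem measurable_crossSpectrum (f u : L2Space d) (α : EuclideanSpace ℝ (Fin d)) :
    Measurable (crossSpectrum f u α) :=
  (measurable_coeFn _).mul (Complex.continuous_conj.measurable.comp
    ((measurable_coeFn _).comp (measurable_add_const α)))

theorem measurable_crossTerm (α : EuclideanSpace ℝ (Fin d)) (p : P) :
    Measurable fun ξ => crossTerm C g h α ξ p :=
  (measurable_const.mul (Complex.continuous_conj.measurable.comp (measurable_coeFn _))).mul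
    ((measurable_coeFn _).comp (measurable_add_const α))

theorem enorm_crossTerm (α ξ : EuclideanSpace ℝ (Fin d)) (p : P) :
    ‖crossTerm C g h α ξ p‖ₑ = ENNReal.ofReal |(C p).det|⁻¹ *
      (‖(𝓕 (h p) : L2Space d) ξ‖ₑ * ‖(𝓕 (g p) : L2Space d) (ξ + α)‖ₑ) := by
  rw [crossTerm, enorm_mul, enorm_mul, RCLike.enorm_conj, ← ofReal_norm, Complex.norm_real,
    Real.norm_of_nonneg (inv_nonneg.2 (abs_nonneg _)), mul_assoc]

/-- The series `∑_{p ∈ P_α} |det C_p|⁻¹ conj(𝓕 h_p(ξ)) 𝓕 g_p(ξ + α)`. -/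
noncomputable def crossSum (C : P → Matrix (Fin d) (Fin d) ℝ) (g h : P → L2Space d)
    (α ξ : EuclideanSpace ℝ (Fin d)) : ℂ :=
  ∑' p : activeIndices C α, crossTerm C g h α ξ p

theorem measurable_crossSum [Countable P] (α : EuclideanSpace ℝ (Fin d)) :
    Measurable (crossSum C g h α) :=
  Measurable.tsum fun p => measurable_crossTerm α p.1

theorem crossSum_zero : crossSum C g h 0 = fun ξ => ∑' p : P, crossTerm C g h 0 ξ p := by
  ext ξ
  rw [crossSum, activeIndices_zero]
  exact tsum_univ fun p => crossTerm C g h 0 ξ p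

theorem crossSum_of_notMem_frequencySet (hC : ∀ p, IsUnit (C p)) {α : EuclideanSpace ℝ (Fin d)}
    (hα : α ∉ frequencySet C) (ξ : EuclideanSpace ℝ (Fin d)) : crossSum C g h α ξ = 0 := by
  have := isEmpty_activeIndices hC hα
  exact tsum_empty

end CrossSum

/-! ### Local finiteness and exhaustion -/

section TestFunctions

variable {d : ℕ} {A : Set (EuclideanSpace ℝ (Fin d))}

/-- The function in `L²` whose Fourier transform is the indicator function of `A`; these are the
test functions of the proof. -/
noncomputable def bandIndicator (hA : MeasurableSet A) (hA' : volume A ≠ ⊤) : L2Space d :=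
  𝓕⁻ (indicatorConstLp 2 hA hA' (1 : ℂ))

theorem fourier_bandIndicator (hA : MeasurableSet A) (hA' : volume A ≠ ⊤) :
    𝓕 (bandIndicator hA hA') = indicatorConstLp 2 hA hA' (1 : ℂ) :=
  FourierTransform.fourier_fourierInv_eq _

theorem coeFn_fourier_bandIndicator (hA : MeasurableSet A) (hA' : volume A ≠ ⊤) :
    (𝓕 (bandIndicator hA hA') : L2Space d) =ᵐ[volume] A.indicator fun _ => 1 := by
  rw [fourier_bandIndicator]
  exact indicatorConstLp_coeFn

theorem isClosed_essSupport (φ : EuclideanSpace ℝ (Fin d) → ℂ) : IsClosed (essSupport φ) := by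
  rw [← isOpen_compl_iff, isOpen_iff_mem_nhds]
  intro ξ hξ
  simp only [essSupport, Set.mem_compl_iff, Set.mem_ofPred_eq, not_forall, not_not] at hξ
  obtain ⟨U, hU, h0⟩ := hξ
  filter_upwards [eventually_mem_nhds_iff.2 hU] with ζ hζ
  simp only [essSupport, Set.mem_compl_iff, Set.mem_ofPred_eq, not_forall, not_not]
  exact ⟨U, hζ, h0⟩

theorem ae_eq_zero_of_notMem_essSupport (φ : EuclideanSpace ℝ (Fin d) → ℂ) :
    ∀ᵐ ξ, ξ ∉ essSupport φ → φ ξ = 0 := by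
  rw [ae_iff]
  refine measure_null_of_locally_null _ fun ξ hξ => ?_
  simp only [Set.mem_ofPred_eq, Classical.not_imp] at hξ
  obtain ⟨hξ, -⟩ := hξ
  simp only [essSupport, Set.mem_ofPred_eq, not_forall, not_not] at hξ
  obtain ⟨U, hU, h0⟩ := hξ
  have hae : φ =ᵐ[volume.restrict (interior U)] 0 :=
    ae_mono (Measure.restrict_mono interior_subset le_rfl) h0
  have hnull := (ae_restrict_iff' isOpen_interior.measurableSet).1 hae
  rw [ae_iff] at hnull
  refine ⟨_, Filter.inter_mem (mem_nhdsWithin_of_mem_nhds (interior_mem_nhds.2 hU))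
    self_mem_nhdsWithin, measure_mono_null ?_ hnull⟩
  rintro ζ ⟨hζ, hζ'⟩
  simp only [Set.mem_ofPred_eq, Classical.not_imp] at hζ' ⊢
  exact ⟨hζ, hζ'.2⟩

theorem essSupport_fourier_bandIndicator_subset (hA : IsClosed A) (hA' : volume A ≠ ⊤) :
    essSupport (𝓕 (bandIndicator hA.measurableSet hA') : L2Space d) ⊆ A := by
  intro ξ hξ
  by_contra hn
  refine hξ Aᶜ (hA.isOpen_compl.mem_nhds hn) ?_
  filter_upwards [ae_restrict_of_ae (coeFn_fourier_bandIndicator hA.measurableSet hA'),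
    ae_restrict_mem hA.measurableSet.compl] with ζ hζ hζA
  rw [hζ, Set.indicator_of_notMem hζA, Pi.zero_apply]

theorem ae_le_essSupport_fourier_bandIndicator (hA : MeasurableSet A) (hA' : volume A ≠ ⊤) :
    A ≤ᵐ[volume] essSupport (𝓕 (bandIndicator hA hA') : L2Space d) := by
  filter_upwards [coeFn_fourier_bandIndicator hA hA',
    ae_eq_zero_of_notMem_essSupport (𝓕 (bandIndicator hA hA') : L2Space d)] with ξ hξ hξ' hξA
  by_contra hn
  rw [hξ' hn, Set.indicator_of_mem hξA] at hξ
  exact zero_ne_one hξ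

theorem bandIndicator_mem_testSpace (hA : IsCompact A) (h0 : 0 ∉ A) :
    bandIndicator hA.measurableSet hA.measure_lt_top.ne ∈ testSpace d := by
  have hsub := essSupport_fourier_bandIndicator_subset hA.isClosed hA.measure_lt_top.ne
  refine ⟨?_, hA.of_isClosed_subset (isClosed_essSupport _) hsub, fun h => h0 (hsub h)⟩
  exact (memLp_congr_ae (coeFn_fourier_bandIndicator _ _)).2
    (memLp_indicator_const ⊤ hA.measurableSet 1 (Or.inr hA.measure_lt_top.ne))

end TestFunctions

section LocalFiniteness

variable {d : ℕ} {P : Type*} {C : P → Matrix (Fin d) (Fin d) ℝ} {g h : P → L2Space d}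
  {K : Set (EuclideanSpace ℝ (Fin d))}

/-- The set of those `ξ ∈ K` with `ξ + α ∈ K`. -/
def overlap (K : Set (EuclideanSpace ℝ (Fin d))) (α : EuclideanSpace ℝ (Fin d)) :
    Set (EuclideanSpace ℝ (Fin d)) :=
  K ∩ (· + α) ⁻¹' K

theorem measurableSet_overlap (hK : MeasurableSet K) (α : EuclideanSpace ℝ (Fin d)) :
    MeasurableSet (overlap K α) :=
  hK.inter (measurable_add_const α hK)

theorem overlap_zero (K : Set (EuclideanSpace ℝ (Fin d))) : overlap K 0 = K := by
  simp [overlap]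

theorem setLIntegral_overlap_comp_add (K : Set (EuclideanSpace ℝ (Fin d)))
    (α : EuclideanSpace ℝ (Fin d)) (F : EuclideanSpace ℝ (Fin d) → ℝ≥0∞) :
    ∫⁻ ξ in overlap K α, F (ξ + α) = ∫⁻ ξ in overlap K (-α), F ξ := by
  have hpre : overlap K α = (· + α) ⁻¹' overlap K (-α) := by
    ext ξ
    simp [overlap, and_comm]
  rw [hpre, (measurePreserving_add_right volume α).setLIntegral_comp_preimage_emb
    (measurableEmbedding_addRight α)]

/-- The local integrability condition, tested on the function with Fourier transform `1_K`. -/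
def LocallyFiniteOn (C : P → Matrix (Fin d) (Fin d) ℝ) (g : P → L2Space d)
    (K : Set (EuclideanSpace ℝ (Fin d))) : Prop :=
  ∑' pl : P × (Fin d → ℤ), ∫⁻ ξ in overlap K (dualFrequency C pl),
    ENNReal.ofReal |(C pl.1).det|⁻¹ * ‖(𝓕 (g pl.1) : L2Space d) ξ‖ₑ ^ 2 < ⊤

theorem LocallyIntegrableSystem.locallyFiniteOn (hg : LocallyIntegrableSystem C g)
    (hK : IsCompact K) (h0 : 0 ∉ K) : LocallyFiniteOn C g K := by
  refine lt_of_le_of_lt ?_ (hg _ (bandIndicator_mem_testSpace hK h0))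
  rw [← ENNReal.tsum_prod]
  refine ENNReal.tsum_le_tsum fun pl => ?_
  have hshift := (measurePreserving_add_right (volume : Measure (EuclideanSpace ℝ (Fin d)))
    (dualFrequency C pl)).quasiMeasurePreserving.ae
      (coeFn_fourier_bandIndicator hK.measurableSet hK.measure_lt_top.ne)
  refine (lintegral_mono_ae ?_).trans (lintegral_mono_set' (Set.inter_subset_left.eventuallyLE.trans
    (ae_le_essSupport_fourier_bandIndicator hK.measurableSet hK.measure_lt_top.ne)))
  filter_upwards [ae_restrict_of_ae hshift,
    ae_restrict_mem (measurableSet_overlap hK.measurableSet _)] with ξ hξ hξK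
  have hξα : ξ + dualFrequency C pl ∈ K := hξK.2
  rw [Set.indicator_of_mem hξα, dualFrequency] at hξ
  simp [hξ]

theorem volume_univ_of_dim_zero :
    (volume : Measure (EuclideanSpace ℝ (Fin 0))) Set.univ = 1 := by
  rw [← (PiLp.volume_preserving_toLp (Fin 0)).measure_preimage MeasurableSet.univ.nullMeasurableSet]
  simp [volume_pi]

-- In dimension zero, `0 ∉ supp 𝓕 f` forces `f = 0`, so the Bessel condition has to replace local
-- integrability.
theorem IsBessel.locallyFiniteOn_univ {C : P → Matrix (Fin 0) (Fin 0) ℝ} {g : P → L2Space 0}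
    (hg : IsBessel (translationSystem C g)) : LocallyFiniteOn C g Set.univ := by
  have hvol : volume (Set.univ : Set (EuclideanSpace ℝ (Fin 0))) ≠ ⊤ := by
    simp [volume_univ_of_dim_zero]
  obtain ⟨M, hM⟩ := hg
  refine lt_of_le_of_lt (ENNReal.tsum_le_tsum fun pk => le_of_eq ?_)
    ((hM (bandIndicator MeasurableSet.univ hvol)).trans_lt
      (ENNReal.mul_lt_top ENNReal.coe_lt_top (by simp)))
  have hcoe : ⇑(𝓕 (bandIndicator MeasurableSet.univ hvol) : L2Space 0) =ᵐ[volume] fun _ => 1 := by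
    simpa using coeFn_fourier_bandIndicator MeasurableSet.univ hvol
  have hconst : ∀ ξ, (𝓕 (g pk.1) : L2Space 0) ξ = (𝓕 (g pk.1) : L2Space 0) 0 := fun ξ => by
    rw [Subsingleton.elim ξ 0]
  have hinner : (inner ℂ (translationSystem C g pk)
      (bandIndicator MeasurableSet.univ hvol) : ℂ) = conj ((𝓕 (g pk.1) : L2Space 0) 0) := by
    rw [translationSystem, inner_translationOp]
    calc _ = ∫ ξ : EuclideanSpace ℝ (Fin 0), conj ((𝓕 (g pk.1) : L2Space 0) 0) := by
          refine integral_congr_ae (hcoe.mono fun ξ hξ => ?_)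
          have hzero : ξ = 0 := Subsingleton.elim ξ 0
          rw [hzero] at hξ
          simp [hξ, hzero]
      _ = _ := by simp [Measure.real, volume_univ_of_dim_zero]
  rw [hinner, lintegral_congr fun ξ => by rw [hconst ξ]]
  simp [overlap, volume_univ_of_dim_zero]

theorem tsum_setLIntegral_overlap_comp_add (C : P → Matrix (Fin d) (Fin d) ℝ)
    (K : Set (EuclideanSpace ℝ (Fin d))) (F : P → EuclideanSpace ℝ (Fin d) → ℝ≥0∞) :
    ∑' pl : P × (Fin d → ℤ), ∫⁻ ξ in overlap K (dualFrequency C pl),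
      F pl.1 (ξ + dualFrequency C pl) =
    ∑' pl : P × (Fin d → ℤ), ∫⁻ ξ in overlap K (dualFrequency C pl), F pl.1 ξ := by
  rw [← ((Equiv.refl P).prodCongr (Equiv.neg (Fin d → ℤ))).tsum_eq fun pl =>
    ∫⁻ ξ in overlap K (dualFrequency C pl), F pl.1 ξ]
  refine tsum_congr fun pl => ?_
  rw [setLIntegral_overlap_comp_add]
  simp [dualFrequency, latticePoint_neg]

theorem LocallyFiniteOn.tsum_lintegral_crossTerm_lt_top (hg : LocallyFiniteOn C g K)
    (hh : LocallyFiniteOn C h K) :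
    ∑' pl : P × (Fin d → ℤ), ∫⁻ ξ in overlap K (dualFrequency C pl),
      ‖crossTerm C g h (dualFrequency C pl) ξ pl.1‖ₑ < ⊤ := by
  rw [LocallyFiniteOn, ← tsum_setLIntegral_overlap_comp_add C K fun p ξ =>
    ENNReal.ofReal |(C p).det|⁻¹ * ‖(𝓕 (g p) : L2Space d) ξ‖ₑ ^ 2] at hg
  refine lt_of_le_of_lt (ENNReal.tsum_le_tsum fun pl => ?_)
    (ENNReal.tsum_add.trans_lt (ENNReal.add_lt_top.2 ⟨hh, hg⟩))
  rw [← lintegral_add_left ((measurable_coeFn _).enorm.pow_const 2 |>.const_mul _)]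
  refine lintegral_mono fun ξ => ?_
  rw [enorm_crossTerm, ← mul_add]
  gcongr
  exact ennreal_mul_le_sq_add_sq _ _

theorem LocallyFiniteOn.tsum_activeIndices_lintegral_lt_top (hC : ∀ p, IsUnit (C p))
    (hg : LocallyFiniteOn C g K) (hh : LocallyFiniteOn C h K) (α : EuclideanSpace ℝ (Fin d)) :
    ∑' p : activeIndices C α, ∫⁻ ξ in overlap K α, ‖crossTerm C g h α ξ p‖ₑ < ⊤ :=
  (tsum_activeIndices_le hC (fun β p => ∫⁻ ξ in overlap K β, ‖crossTerm C g h β ξ p‖ₑ) α).trans_lt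
    (hg.tsum_lintegral_crossTerm_lt_top hh)

variable [Countable P]

theorem LocallyFiniteOn.lintegral_tsum_activeIndices_lt_top (hC : ∀ p, IsUnit (C p))
    (hg : LocallyFiniteOn C g K) (hh : LocallyFiniteOn C h K) (α : EuclideanSpace ℝ (Fin d)) :
    ∫⁻ ξ in overlap K α, ∑' p : activeIndices C α, ‖crossTerm C g h α ξ p‖ₑ < ⊤ := by
  have hm : ∀ p : activeIndices C α, Measurable fun ξ => crossTerm C g h α ξ p := fun p =>
    measurable_crossTerm α p.1
  rw [lintegral_tsum fun p => (hm p).enorm.aemeasurable]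
  exact hg.tsum_activeIndices_lintegral_lt_top hC hh α

theorem LocallyFiniteOn.integrableOn_crossSum (hC : ∀ p, IsUnit (C p))
    (hg : LocallyFiniteOn C g K) (hh : LocallyFiniteOn C h K) (α : EuclideanSpace ℝ (Fin d)) :
    IntegrableOn (crossSum C g h α) (overlap K α) :=
  ⟨(measurable_crossSum α).aestronglyMeasurable,
    (lintegral_mono fun _ => enorm_tsum_le_tsum_enorm).trans_lt
      (hg.lintegral_tsum_activeIndices_lt_top hC hh α)⟩

theorem LocallyFiniteOn.ae_summable_crossTerm (hC : ∀ p, IsUnit (C p)) (hK : MeasurableSet K)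
    (hg : LocallyFiniteOn C g K) (hh : LocallyFiniteOn C h K) (α : EuclideanSpace ℝ (Fin d)) :
    ∀ᵐ ξ, ξ ∈ overlap K α → Summable fun p : activeIndices C α => crossTerm C g h α ξ p := by
  have hm : ∀ p : activeIndices C α, Measurable fun ξ => crossTerm C g h α ξ p := fun p =>
    measurable_crossTerm α p.1
  rw [← ae_restrict_iff' (measurableSet_overlap hK α)]
  filter_upwards [ae_lt_top (Measurable.tsum fun p => (hm p).enorm)
    (hg.lintegral_tsum_activeIndices_lt_top hC hh α).ne] with ξ hξ
  exact .of_enorm hξ.ne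

end LocalFiniteness

section Exhaustion

variable {d : ℕ} {P : Type*} {C : P → Matrix (Fin d) (Fin d) ℝ} {g h : P → L2Space d}

/-- A frequency window: a set of finite measure on which the local integrability sums of both
systems are finite. -/
structure IsWindow (C : P → Matrix (Fin d) (Fin d) ℝ) (g h : P → L2Space d)
    (K : Set (EuclideanSpace ℝ (Fin d))) : Prop where
  measurableSet : MeasurableSet K
  measure_lt_top : volume K < ⊤
  left : LocallyFiniteOn C g K
  right : LocallyFiniteOn C h K

theorem LocallyIntegrableSystem.isWindow (hg : LocallyIntegrableSystem C g)
    (hh : LocallyIntegrableSystem C h) {K : Set (EuclideanSpace ℝ (Fin d))} (hK : IsCompact K)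
    (h0 : 0 ∉ K) : IsWindow C g h K :=
  ⟨hK.measurableSet, hK.measure_lt_top, hg.locallyFiniteOn hK h0, hh.locallyFiniteOn hK h0⟩

/-- The closed spherical shell with radii `1 / (n + 1)` and `n + 1`. -/
def shell (E : Type*) [NormedAddCommGroup E] (n : ℕ) : Set E :=
  Metric.closedBall 0 ((n : ℝ) + 1) \ Metric.ball 0 (1 / ((n : ℝ) + 1))

theorem monotone_shell (E : Type*) [NormedAddCommGroup E] : Monotone (shell E) := by
  intro m n hmn
  have hmn' : (m : ℝ) ≤ n := Nat.cast_le.2 hmn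
  exact Set.sdiff_subset_sdiff (Metric.closedBall_subset_closedBall (by gcongr))
    (Metric.ball_subset_ball (by gcongr))

theorem aecover_shell (E : Type*) [NormedAddCommGroup E] [MeasurableSpace E]
    [OpensMeasurableSpace E] (μ : Measure E) [NullSingletonClass μ] :
    AECover μ Filter.atTop (shell E) where
  measurableSet _ := Metric.isClosed_closedBall.measurableSet.diff Metric.isOpen_ball.measurableSet
  ae_eventually_mem := by
    filter_upwards [measure_eq_zero_iff_ae_notMem.1 (measure_singleton (μ := μ) 0)] with x hx
    have hlim := tendsto_one_div_add_atTop_nhds_zero_nat (𝕜 := ℝ)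
    filter_upwards [hlim.eventually_lt_const (norm_pos_iff.2 hx),
      Filter.eventually_ge_atTop ⌈‖x‖⌉₊] with n hn hn'
    refine ⟨?_, ?_⟩
    · rw [mem_closedBall_zero_iff]
      exact (Nat.ceil_le.1 hn').trans (le_add_of_nonneg_right zero_le_one)
    · rw [mem_ball_zero_iff, not_lt]
      exact hn.le

theorem exists_monotone_aecover_isWindow (hgB : IsBessel (translationSystem C g))
    (hhB : IsBessel (translationSystem C h))
    (hgL : LocallyIntegrableSystem C g) (hhL : LocallyIntegrableSystem C h) :
    ∃ K : ℕ → Set (EuclideanSpace ℝ (Fin d)), Monotone K ∧ AECover volume Filter.atTop K ∧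
      ∀ n, IsWindow C g h (K n) := by
  rcases Nat.eq_zero_or_pos d with rfl | hd
  · exact ⟨fun _ => Set.univ, monotone_const, ⟨by simp, fun _ => MeasurableSet.univ⟩, fun _ =>
      ⟨MeasurableSet.univ, isCompact_univ.measure_lt_top, hgB.locallyFiniteOn_univ,
        hhB.locallyFiniteOn_univ⟩⟩
  · have : Nonempty (Fin d) := ⟨⟨0, hd⟩⟩
    exact ⟨shell _, monotone_shell _, aecover_shell _ _, fun n => hgL.isWindow hhL
      ((isCompact_closedBall _ _).diff Metric.isOpen_ball)
      fun h0 => h0.2 (Metric.mem_ball_self (by positivity))⟩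

theorem ae_exists_mem_overlap {K : ℕ → Set (EuclideanSpace ℝ (Fin d))}
    (hK : AECover volume Filter.atTop K) (α : EuclideanSpace ℝ (Fin d)) :
    ∀ᵐ ξ, ∃ n, ξ ∈ overlap (K n) α := by
  filter_upwards [hK.ae_eventually_mem, (measurePreserving_add_right volume
    α).quasiMeasurePreserving.ae hK.ae_eventually_mem] with ξ hξ hξα
  exact (hξ.and hξα).exists

theorem ae_of_forall_ae_mem_overlap {K : ℕ → Set (EuclideanSpace ℝ (Fin d))}
    (hK : AECover volume Filter.atTop K) {α : EuclideanSpace ℝ (Fin d)}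
    {p : EuclideanSpace ℝ (Fin d) → Prop} (hp : ∀ n, ∀ᵐ ξ, ξ ∈ overlap (K n) α → p ξ) :
    ∀ᵐ ξ, p ξ := by
  filter_upwards [ae_exists_mem_overlap hK α, ae_all_iff.2 hp] with ξ ⟨n, hn⟩ hξ
  exact hξ n hn

end Exhaustion

/-! ### Expansion of the mixed Gramian on band-limited functions -/

section BandLimited

variable {d : ℕ} {K : Set (EuclideanSpace ℝ (Fin d))} {f f₁ f₂ : L2Space d}

/-- `f` is band-limited to `K`: its Fourier transform is essentially bounded and vanishes almost
everywhere outside `K`. -/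
def IsBandLimited (K : Set (EuclideanSpace ℝ (Fin d))) (f : L2Space d) : Prop :=
  MemLp (𝓕 f : L2Space d) ∞ volume ∧ ∀ᵐ ξ, ξ ∉ K → (𝓕 f : L2Space d) ξ = 0

theorem isBandLimited_bandIndicator {A : Set (EuclideanSpace ℝ (Fin d))} (hA : MeasurableSet A)
    (hA' : volume A ≠ ⊤) (hAK : A ⊆ K) : IsBandLimited K (bandIndicator hA hA') := by
  have hcoe := coeFn_fourier_bandIndicator hA hA'
  refine ⟨(memLp_congr_ae hcoe).2 (memLp_indicator_const ⊤ hA 1 (Or.inr hA')), ?_⟩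
  filter_upwards [hcoe] with ξ hξ hξK
  rw [hξ, Set.indicator_of_notMem fun hξA => hξK (hAK hξA)]

namespace IsBandLimited

theorem mono {K' : Set (EuclideanSpace ℝ (Fin d))} (hf : IsBandLimited K f) (hK : K ⊆ K') :
    IsBandLimited K' f :=
  ⟨hf.1, hf.2.mono fun _ hξ hK' => hξ fun hξK => hK' (hK hξK)⟩

theorem translationOp (hf : IsBandLimited K f) (β : EuclideanSpace ℝ (Fin d)) :
    IsBandLimited K (translationOp β f) := by
  have hfourier := fourier_translationOp β f
  refine ⟨(memLp_congr_ae hfourier).2 (hf.1.mul (memLp_top_fourierChar_neg_inner β)), ?_⟩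
  filter_upwards [hfourier, hf.2] with ξ hξ hξ' hξK
  rw [hξ, hξ' hξK, mul_zero]

theorem enorm_crossSpectrum_le (hf₁ : IsBandLimited K f₁) (hf₂ : IsBandLimited K f₂)
    (α : EuclideanSpace ℝ (Fin d)) :
    ∀ᵐ ξ, ‖crossSpectrum f₁ f₂ α ξ‖ₑ ≤ (overlap K α).indicator (fun _ =>
      eLpNormEssSup (𝓕 f₁ : L2Space d) volume * eLpNormEssSup (𝓕 f₂ : L2Space d) volume) ξ := by
  have hshift := (measurePreserving_add_right (volume : Measure (EuclideanSpace ℝ (Fin d)))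
    α).quasiMeasurePreserving.ae (hf₂.2.and (enorm_ae_le_eLpNormEssSup (𝓕 f₂ : L2Space d) volume))
  filter_upwards [hf₁.2, enorm_ae_le_eLpNormEssSup (𝓕 f₁ : L2Space d) volume, hshift]
    with ξ hξ hbound ⟨hξα, hbound'⟩
  by_cases hmem : ξ ∈ overlap K α
  · rw [Set.indicator_of_mem hmem, crossSpectrum, enorm_mul, RCLike.enorm_conj]
    gcongr
  · rw [Set.indicator_of_notMem hmem, crossSpectrum]
    rcases not_and_or.1 hmem with hK | hK
    · simp [hξ hK]
    · simp [hξα hK]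

end IsBandLimited

end BandLimited

section MixedGramian

variable {H : Type*} [NormedAddCommGroup H] [InnerProductSpace ℂ H] [CompleteSpace H] {ι : Type*}

theorem adjoint_analysisOp_single [DecidableEq ι] {y : ι → H} (hy : IsBessel y) (j : ι) (a : ℂ) :
    ContinuousLinearMap.adjoint (analysisOp y hy) (lp.single 2 j a) = a • y j := by
  refine ext_inner_left ℂ fun v => ?_
  rw [ContinuousLinearMap.adjoint_inner_right, lp.inner_single_right, inner_smul_right]
  change inner ℂ (inner ℂ (y j) v) a = _
  rw [RCLike.inner_apply, inner_conj_symm]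

theorem hasSum_mixedGramian {x y : ι → H} (hx : IsBessel x) (hy : IsBessel y) (v : H) :
    HasSum (fun j => (inner ℂ (x j) v : ℂ) • y j) (mixedGramian x y hx hy v) := by
  classical
  have hsum := (lp.hasSum_single (p := 2) (by norm_num) (analysisOp x hx v)).mapL
    (ContinuousLinearMap.adjoint (analysisOp y hy))
  simp only [adjoint_analysisOp_single] at hsum
  exact hsum

end MixedGramian

section Expansion

variable {d : ℕ} {P : Type*} {C : P → Matrix (Fin d) (Fin d) ℝ} {g h : P → L2Space d}
  {K : Set (EuclideanSpace ℝ (Fin d))} {f f₁ f₂ : L2Space d}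

/-- The integral of the cross-spectrum of `f₁` and `f₂` against the term of index `p`, at the
frequency offset `α`. At `α = C_p' l` it is a coefficient of the almost periodic function
`x ↦ ⟨Θ T_x f₁, T_x f₂⟩`. -/
noncomputable def gramianCoeff (C : P → Matrix (Fin d) (Fin d) ℝ) (g h : P → L2Space d)
    (f₁ f₂ : L2Space d) (α : EuclideanSpace ℝ (Fin d)) (p : P) : ℂ :=
  ∫ ξ, crossSpectrum f₁ f₂ α ξ * crossTerm C g h α ξ p

theorem gramianCoeff_translationOp (x α : EuclideanSpace ℝ (Fin d)) (p : P) :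
    gramianCoeff C g h (translationOp x f₁) (translationOp x f₂) α p =
      gramianCoeff C g h f₁ f₂ α p * 𝐞 (inner ℝ α x) := by
  have hshift := (measurePreserving_add_right (volume : Measure (EuclideanSpace ℝ (Fin d)))
    α).quasiMeasurePreserving.ae (fourier_translationOp x f₂)
  have hchar : ∀ ξ, (𝐞 (-inner ℝ x ξ) : ℂ) * conj (𝐞 (-inner ℝ x (ξ + α)) : ℂ) =
      𝐞 (inner ℝ α x) := fun ξ => by
    rw [← Circle.coe_inv_eq_conj, ← AddChar.map_neg_eq_inv, neg_neg, ← Circle.coe_mul,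
      ← AddChar.map_add_eq_mul, inner_add_right, neg_add_cancel_left, real_inner_comm]
  rw [gramianCoeff, gramianCoeff, ← integral_mul_const]
  refine integral_congr_ae ?_
  filter_upwards [fourier_translationOp x f₁, hshift] with ξ hξ hξα
  simp only [crossSpectrum, hξ, hξα, map_mul, ← hchar ξ]
  ring

theorem IsBandLimited.lintegral_crossSpectrum_mul_le (hf₁ : IsBandLimited K f₁)
    (hf₂ : IsBandLimited K f₂) (α : EuclideanSpace ℝ (Fin d))
    {F : EuclideanSpace ℝ (Fin d) → ℂ} (hF : Measurable F) :
    ∫⁻ ξ, ‖crossSpectrum f₁ f₂ α ξ * F ξ‖ₑ ≤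
      eLpNormEssSup (𝓕 f₁ : L2Space d) volume * eLpNormEssSup (𝓕 f₂ : L2Space d) volume *
        ∫⁻ ξ in overlap K α, ‖F ξ‖ₑ := by
  rw [← lintegral_const_mul _ hF.enorm]
  refine (lintegral_mono_ae ?_).trans (lintegral_indicator_le _ _)
  filter_upwards [hf₁.enorm_crossSpectrum_le hf₂ α] with ξ hξ
  rw [enorm_mul]
  refine (mul_le_mul_left hξ _).trans_eq ?_
  by_cases hmem : ξ ∈ overlap K α <;> simp [hmem]

theorem LocallyFiniteOn.tsum_lintegral_crossSpectrum_mul_crossTerm_lt_top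
    (hg : LocallyFiniteOn C g K) (hh : LocallyFiniteOn C h K) (hf₁ : IsBandLimited K f₁)
    (hf₂ : IsBandLimited K f₂) :
    ∑' pl : P × (Fin d → ℤ), ∫⁻ ξ, ‖crossSpectrum f₁ f₂ (dualFrequency C pl) ξ *
      crossTerm C g h (dualFrequency C pl) ξ pl.1‖ₑ < ⊤ := by
  have hm : ∀ pl : P × (Fin d → ℤ), Measurable fun ξ =>
      crossTerm C g h (dualFrequency C pl) ξ pl.1 := fun pl => measurable_crossTerm _ pl.1
  refine (ENNReal.tsum_le_tsum fun pl =>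
    hf₁.lintegral_crossSpectrum_mul_le hf₂ _ (hm pl)).trans_lt ?_
  rw [ENNReal.tsum_mul_left]
  have hfin : ∀ {u : L2Space d}, IsBandLimited K u →
      eLpNormEssSup (𝓕 u : L2Space d) volume < ⊤ := fun hu => by
    simpa only [eLpNorm_exponent_top] using hu.1.2
  exact ENNReal.mul_lt_top (ENNReal.mul_lt_top (hfin hf₁) (hfin hf₂))
    (hg.tsum_lintegral_crossTerm_lt_top hh)

theorem LocallyFiniteOn.summable_gramianCoeff (hg : LocallyFiniteOn C g K)
    (hh : LocallyFiniteOn C h K) (hf₁ : IsBandLimited K f₁) (hf₂ : IsBandLimited K f₂) :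
    Summable fun pl : P × (Fin d → ℤ) => gramianCoeff C g h f₁ f₂ (dualFrequency C pl) pl.1 :=
  .of_enorm ((ENNReal.tsum_le_tsum fun _ => enorm_integral_le_lintegral_enorm _).trans_lt
    (hg.tsum_lintegral_crossSpectrum_mul_crossTerm_lt_top hh hf₁ hf₂)).ne

theorem LocallyFiniteOn.finiteAutocorrelation (hC : ∀ p, IsUnit (C p))
    (hg : LocallyFiniteOn C g K) (hf : IsBandLimited K f) (p : P) :
    FiniteAutocorrelation (crossSpectrum f (g p) 0 ∘ dualParam (C p)) := by
  refine finiteAutocorrelation_comp_dualParam (hC p) (measurable_crossSpectrum _ _ _) ?_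
  have hdet : ENNReal.ofReal |(C p).det| * ENNReal.ofReal |(C p).det|⁻¹ = 1 := by
    rw [← ENNReal.ofReal_mul (abs_nonneg _), mul_inv_cancel₀ (abs_ne_zero.2
      ((Matrix.isUnit_iff_isUnit_det _).1 (hC p)).ne_zero), ENNReal.ofReal_one]
  have hterm : ∀ l ξ, ‖crossSpectrum f (g p) 0 ξ‖ₑ *
      ‖crossSpectrum f (g p) 0 (ξ + latticePoint (dualMatrix (C p)) l)‖ₑ =
      ENNReal.ofReal |(C p).det| * ‖crossSpectrum f f (dualFrequency C (p, l)) ξ *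
        crossTerm C g g (dualFrequency C (p, l)) ξ p‖ₑ := fun l ξ => by
    simp only [crossSpectrum, enorm_mul, RCLike.enorm_conj, enorm_crossTerm, add_zero,
      dualFrequency]
    rw [← one_mul (_ * _), ← hdet]
    ring
  have hm : ∀ l : Fin d → ℤ, Measurable fun ξ => crossSpectrum f f (dualFrequency C (p, l)) ξ *
      crossTerm C g g (dualFrequency C (p, l)) ξ p := fun l =>
    (measurable_crossSpectrum _ _ _).mul (measurable_crossTerm _ p)
  simp only [hterm, lintegral_const_mul _ (hm _).enorm, ENNReal.tsum_mul_left]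
  exact ENNReal.mul_lt_top ENNReal.ofReal_lt_top
    ((ENNReal.tsum_comp_le_tsum_of_injective (Prod.mk_right_injective p) _).trans_lt
      (hg.tsum_lintegral_crossSpectrum_mul_crossTerm_lt_top hg hf hf))

theorem LocallyFiniteOn.hasSum_inner_translationSystem (hC : ∀ p, IsUnit (C p))
    (hg : LocallyFiniteOn C g K) (hh : LocallyFiniteOn C h K) (hf₁ : IsBandLimited K f₁)
    (hf₂ : IsBandLimited K f₂) (p : P) :
    HasSum (fun k : Fin d → ℤ => (inner ℂ (translationSystem C h (p, k)) f₁ : ℂ) *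
        inner ℂ f₂ (translationSystem C g (p, k)))
      (∑' l : Fin d → ℤ, gramianCoeff C g h f₁ f₂ (dualFrequency C (p, l)) p) := by
  have hinner : ∀ (u : P → L2Space d) (f : L2Space d) (k : Fin d → ℤ),
      (inner ℂ (translationSystem C u (p, k)) f : ℂ) =
        ∫ ξ, crossSpectrum f (u p) 0 ξ * 𝐞 (inner ℝ (latticePoint (C p) k) ξ) := fun u f k => by
    simp only [crossSpectrum, add_zero]
    exact inner_translationOp _ _ _
  have hterm : ∀ l : Fin d → ℤ, ((|(C p).det|⁻¹ : ℝ) : ℂ) * ∫ ξ, crossSpectrum f₁ (h p) 0 ξ *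
      conj (crossSpectrum f₂ (g p) 0 (ξ + latticePoint (dualMatrix (C p)) l)) =
      gramianCoeff C g h f₁ f₂ (dualFrequency C (p, l)) p := fun l => by
    rw [gramianCoeff, ← integral_const_mul]
    congr 1 with ξ
    simp only [crossSpectrum, crossTerm, add_zero, dualFrequency, map_mul, Complex.conj_conj]
    ring
  have hParseval := hasSum_integral_fourierChar_latticePoint_mul_conj (hC p)
    (measurable_crossSpectrum _ _ _) (measurable_crossSpectrum _ _ _)
    (hh.finiteAutocorrelation hC hf₁ p) (hg.finiteAutocorrelation hC hf₂ p)
  rw [← tsum_mul_left] at hParseval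
  simpa only [hterm, ← hinner, inner_conj_symm] using hParseval

theorem LocallyFiniteOn.inner_mixedGramian (hC : ∀ p, IsUnit (C p))
    (hgB : IsBessel (translationSystem C g)) (hhB : IsBessel (translationSystem C h))
    (hg : LocallyFiniteOn C g K) (hh : LocallyFiniteOn C h K) (hf₁ : IsBandLimited K f₁)
    (hf₂ : IsBandLimited K f₂) :
    inner ℂ f₂ (mixedGramian (translationSystem C h) (translationSystem C g) hhB hgB f₁) =
      ∑' pl : P × (Fin d → ℤ), gramianCoeff C g h f₁ f₂ (dualFrequency C pl) pl.1 := by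
  have hΘ := (hasSum_mixedGramian hhB hgB f₁).mapL (innerSL ℂ f₂)
  simp only [innerSL_apply_apply, inner_smul_right] at hΘ
  have hsum := hg.summable_gramianCoeff hh hf₁ hf₂
  exact (hΘ.prod_fiberwise (hg.hasSum_inner_translationSystem hC hh hf₁ hf₂)).unique
    (hsum.hasSum.prod_fiberwise fun p => (hsum.prod_factor p).hasSum)

theorem LocallyFiniteOn.tsum_fiber_gramianCoeff [Countable P] (hC : ∀ p, IsUnit (C p))
    (hg : LocallyFiniteOn C g K) (hh : LocallyFiniteOn C h K) (hf₁ : IsBandLimited K f₁)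
    (hf₂ : IsBandLimited K f₂) (α : EuclideanSpace ℝ (Fin d)) :
    ∑' pl : dualFrequency C ⁻¹' {α}, gramianCoeff C g h f₁ f₂ (dualFrequency C pl) pl.1.1 =
      ∫ ξ, crossSpectrum f₁ f₂ α ξ * crossSum C g h α ξ := by
  have hfin := (tsum_activeIndices_le hC (fun β p =>
      ∫⁻ ξ, ‖crossSpectrum f₁ f₂ β ξ * crossTerm C g h β ξ p‖ₑ) α).trans_lt
    (hg.tsum_lintegral_crossSpectrum_mul_crossTerm_lt_top hh hf₁ hf₂)
  have hm : ∀ p : activeIndices C α, Measurable fun ξ =>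
      crossSpectrum f₁ f₂ α ξ * crossTerm C g h α ξ p := fun p =>
    (measurable_crossSpectrum _ _ _).mul (measurable_crossTerm _ p.1)
  rw [tsum_dualFrequency_fiber hC (gramianCoeff C g h f₁ f₂) α]
  simp only [crossSum, gramianCoeff, ← tsum_mul_left]
  exact (integral_tsum (fun p => (hm p).aestronglyMeasurable) hfin.ne).symm

end Expansion

/-! ### Operators commuting with all translations -/

section GeneralFacts

theorem ae_norm_le_of_norm_setIntegral_le {X E : Type*} [MetricSpace X]
    [SecondCountableTopology X] [HasBesicovitchCovering X] [MeasurableSpace X] [BorelSpace X]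
    {μ : Measure X} [IsLocallyFiniteMeasure μ] [NormedAddCommGroup E] [NormedSpace ℝ E]
    [CompleteSpace E] {f : X → E} (hf : LocallyIntegrable f μ) {M : ℝ} (hM : 0 ≤ M)
    (h : ∀ A, MeasurableSet A → μ A < ⊤ → ‖∫ x in A, f x ∂μ‖ ≤ M * μ.real A) :
    ∀ᵐ x ∂μ, ‖f x‖ ≤ M := by
  filter_upwards [(Besicovitch.vitaliFamily μ).ae_tendsto_average hf] with x hx
  refine le_of_tendsto hx.norm ?_
  filter_upwards [(Besicovitch.vitaliFamily μ).eventually_filterAt_measurableSet x,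
    (Besicovitch.vitaliFamily μ).eventually_measure_lt_top x] with A hA hAfin
  rw [setAverage_eq, norm_smul, norm_inv, Real.norm_of_nonneg measureReal_nonneg, inv_mul_eq_div]
  exact div_le_of_le_mul₀ measureReal_nonneg hM (h A hA hAfin)

theorem clm_ext_inner_of_dense_span {𝕜 E F : Type*} [RCLike 𝕜] [NormedAddCommGroup E]
    [NormedSpace 𝕜 E] [NormedAddCommGroup F] [InnerProductSpace 𝕜 F] {S : Set E} {T : Set F}
    (hS : Dense (Submodule.span 𝕜 S : Set E)) (hT : Dense (Submodule.span 𝕜 T : Set F))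
    {Θ Ψ : E →L[𝕜] F} (h : ∀ x ∈ S, ∀ y ∈ T, inner 𝕜 y (Θ x) = inner 𝕜 y (Ψ x)) : Θ = Ψ := by
  refine ContinuousLinearMap.ext_on hS fun x hx => (innerSL_inj (𝕜 := 𝕜)).1 ?_
  refine ContinuousLinearMap.ext_on hT fun y hy => ?_
  rw [innerSL_apply_apply, innerSL_apply_apply, ← inner_conj_symm, h x hx y hy, inner_conj_symm]

end GeneralFacts

section Windows

variable {d : ℕ} {A B : Set (EuclideanSpace ℝ (Fin d))}

theorem inner_bandIndicator (hA : MeasurableSet A) (hA' : volume A ≠ ⊤) (f : L2Space d) :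
    (inner ℂ (bandIndicator hA hA') f : ℂ) = ∫ ξ in A, (𝓕 f : L2Space d) ξ := by
  rw [← Lp.inner_fourier_eq, fourier_bandIndicator, L2.inner_indicatorConstLp_one]

theorem norm_bandIndicator_sq (hA : MeasurableSet A) (hA' : volume A ≠ ⊤) :
    ‖bandIndicator hA hA'‖ ^ 2 = volume.real A := by
  rw [← Lp.norm_fourier_eq, fourier_bandIndicator,
    norm_indicatorConstLp two_ne_zero ENNReal.ofNat_ne_top, norm_one, one_mul,
    ENNReal.toReal_ofNat, ← Real.sqrt_eq_rpow, Real.sq_sqrt measureReal_nonneg]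

theorem integral_crossSpectrum_bandIndicator_mul (hA : MeasurableSet A) (hA' : volume A ≠ ⊤)
    (hB : MeasurableSet B) (hB' : volume B ≠ ⊤) {α : EuclideanSpace ℝ (Fin d)}
    (hAB : ∀ ξ ∈ A, ξ + α ∈ B) (F : EuclideanSpace ℝ (Fin d) → ℂ) :
    ∫ ξ, crossSpectrum (bandIndicator hA hA') (bandIndicator hB hB') α ξ * F ξ =
      ∫ ξ in A, F ξ := by
  have hshift := (measurePreserving_add_right (volume : Measure (EuclideanSpace ℝ (Fin d)))
    α).quasiMeasurePreserving.ae (coeFn_fourier_bandIndicator hB hB')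
  rw [← integral_indicator hA]
  refine integral_congr_ae ?_
  filter_upwards [coeFn_fourier_bandIndicator hA hA', hshift] with ξ hξ hξα
  by_cases hmem : ξ ∈ A
  · simp [crossSpectrum, hξ, hξα, hmem, hAB ξ hmem]
  · simp [crossSpectrum, hξ, hmem]

theorem dense_span_isBandLimited {K : ℕ → Set (EuclideanSpace ℝ (Fin d))}
    (hK : AECover volume Filter.atTop K) (hfin : ∀ n, volume (K n) < ⊤) :
    Dense (Submodule.span ℂ {f : L2Space d | ∃ n, IsBandLimited (K n) f} : Set (L2Space d)) := by
  rw [Submodule.dense_iff_topologicalClosure_eq_top, Submodule.topologicalClosure_eq_top_iff,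
    Submodule.eq_bot_iff]
  intro v hv
  have hzero : ∀ n, ∀ᵐ ξ, ξ ∈ K n → (𝓕 v : L2Space d) ξ = 0 := fun n => by
    rw [← ae_restrict_iff' (hK.measurableSet n)]
    have : IsFiniteMeasure (volume.restrict (K n)) := ⟨by simpa using hfin n⟩
    refine Integrable.ae_eq_zero_of_forall_setIntegral_eq_zero
      ((Lp.memLp (𝓕 v : L2Space d)).restrict (K n) |>.integrable one_le_two) fun A hA _ => ?_
    have hAK := hA.inter (hK.measurableSet n)
    have hAK' : volume (A ∩ K n) ≠ ⊤ :=
      ((measure_mono Set.inter_subset_right).trans_lt (hfin n)).ne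
    rw [Measure.restrict_restrict hA, ← inner_bandIndicator hAK hAK']
    exact (Submodule.mem_orthogonal _ v).1 hv _ (Submodule.subset_span
      ⟨n, isBandLimited_bandIndicator hAK hAK' Set.inter_subset_right⟩)
  rw [← norm_eq_zero, ← Lp.norm_fourier_eq, norm_eq_zero, Lp.eq_zero_iff_ae_eq_zero]
  filter_upwards [hK.ae_eventually_mem, ae_all_iff.2 hzero] with ξ hξ hξ'
  obtain ⟨n, hn⟩ := hξ.exists
  exact hξ' n hn

theorem IsFourierMultiplier.inner_eq_integral_crossSpectrum {Θ : L2Space d →L[ℂ] L2Space d}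
    {s : EuclideanSpace ℝ (Fin d) → ℂ} (hΘ : IsFourierMultiplier Θ s) (f₁ f₂ : L2Space d) :
    (inner ℂ f₂ (Θ f₁) : ℂ) = ∫ ξ, crossSpectrum f₁ f₂ 0 ξ * s ξ := by
  rw [← Lp.inner_fourier_eq, L2.inner_def]
  refine integral_congr_ae ?_
  filter_upwards [hΘ.2 f₁] with ξ hξ
  rw [RCLike.inner_apply, hξ, crossSpectrum, add_zero]
  ring

end Windows

section Commutant

variable {d : ℕ} {P : Type*} [Countable P] {C : P → Matrix (Fin d) (Fin d) ℝ} {g h : P → L2Space d}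
  {K : Set (EuclideanSpace ℝ (Fin d))} {f₁ f₂ : L2Space d} {α : EuclideanSpace ℝ (Fin d)}
  {hgB : IsBessel (translationSystem C g)} {hhB : IsBessel (translationSystem C h)}

namespace IsWindow

theorem integral_crossSpectrum_mul_crossSum_eq_zero (hC : ∀ p, IsUnit (C p))
    (hK : IsWindow C g h K)
    (hcomm : ∀ x, Commute (mixedGramian (translationSystem C h) (translationSystem C g) hhB hgB)
      (translationOp x))
    (hf₁ : IsBandLimited K f₁) (hf₂ : IsBandLimited K f₂) (hα : α ≠ 0) :
    ∫ ξ, crossSpectrum f₁ f₂ α ξ * crossSum C g h α ξ = 0 := by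
  rw [← hK.left.tsum_fiber_gramianCoeff hC hK.right hf₁ hf₂]
  refine tsum_fiber_eq_zero_of_tsum_mul_fourierChar_eq_const
    (hK.left.summable_gramianCoeff hK.right hf₁ hf₂) (a := inner ℂ f₂
      (mixedGramian (translationSystem C h) (translationSystem C g) hhB hgB f₁)) (fun x => ?_) hα
  simp only [← gramianCoeff_translationOp]
  rw [← hK.left.inner_mixedGramian hC hgB hhB hK.right (hf₁.translationOp x)
    (hf₂.translationOp x), ← inner_translationOp_translationOp x f₂]
  exact congrArg (inner ℂ (translationOp x f₂)) (DFunLike.congr_fun (hcomm x).eq f₁)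

theorem ae_crossSum_eq_zero (hC : ∀ p, IsUnit (C p)) (hK : IsWindow C g h K)
    (hcomm : ∀ x, Commute (mixedGramian (translationSystem C h) (translationSystem C g) hhB hgB)
      (translationOp x)) (hα : α ≠ 0) :
    ∀ᵐ ξ, ξ ∈ overlap K α → crossSum C g h α ξ = 0 := by
  have hoverlap := measurableSet_overlap hK.measurableSet α
  rw [← ae_restrict_iff' hoverlap]
  refine Integrable.ae_eq_zero_of_forall_setIntegral_eq_zero
    (hK.left.integrableOn_crossSum hC hK.right α) fun A hA _ => ?_
  have hAK : A ∩ overlap K α ⊆ K := fun ξ hξ => hξ.2.1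
  have hA' := hA.inter hoverlap
  have hfin : volume (A ∩ overlap K α) ≠ ⊤ := ((measure_mono hAK).trans_lt hK.measure_lt_top).ne
  rw [Measure.restrict_restrict hA, ← integral_crossSpectrum_bandIndicator_mul hA' hfin
    hK.measurableSet hK.measure_lt_top.ne fun ξ hξ => hξ.2.2]
  exact hK.integral_crossSpectrum_mul_crossSum_eq_zero hC hcomm
    (isBandLimited_bandIndicator _ _ hAK) (isBandLimited_bandIndicator _ _ subset_rfl) hα

theorem inner_mixedGramian (hC : ∀ p, IsUnit (C p)) (hK : IsWindow C g h K)
    (hcross : ∀ α ≠ 0, ∀ᵐ ξ, crossSum C g h α ξ = 0)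
    (hf₁ : IsBandLimited K f₁) (hf₂ : IsBandLimited K f₂) :
    inner ℂ f₂ (mixedGramian (translationSystem C h) (translationSystem C g) hhB hgB f₁) =
      ∫ ξ, crossSpectrum f₁ f₂ 0 ξ * crossSum C g h 0 ξ := by
  rw [hK.left.inner_mixedGramian hC hgB hhB hK.right hf₁ hf₂,
    ← hK.left.tsum_fiber_gramianCoeff hC hK.right hf₁ hf₂]
  refine tsum_eq_tsum_fiber (hK.left.summable_gramianCoeff hK.right hf₁ hf₂) fun α hα => ?_
  rw [hK.left.tsum_fiber_gramianCoeff hC hK.right hf₁ hf₂]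
  refine integral_eq_zero_of_ae ?_
  filter_upwards [hcross α hα] with ξ hξ
  rw [hξ, mul_zero, Pi.zero_apply]

theorem ae_norm_crossSum_zero_le (hC : ∀ p, IsUnit (C p)) (hK : IsWindow C g h K)
    (hcross : ∀ α ≠ 0, ∀ᵐ ξ, crossSum C g h α ξ = 0) :
    ∀ᵐ ξ, ξ ∈ K → ‖crossSum C g h 0 ξ‖ ≤
      ‖mixedGramian (translationSystem C h) (translationSystem C g) hhB hgB‖ := by
  set Θ := mixedGramian (translationSystem C h) (translationSystem C g) hhB hgB
  have hint : IntegrableOn (crossSum C g h 0) K := by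
    simpa only [overlap_zero] using hK.left.integrableOn_crossSum hC hK.right 0
  have hbound := ae_norm_le_of_norm_setIntegral_le
    (hint.integrable_indicator hK.measurableSet).locallyIntegrable (norm_nonneg Θ)
    fun A hA hAfin => by
      have hAK := hA.inter hK.measurableSet
      have hfin : volume (A ∩ K) ≠ ⊤ :=
        ((measure_mono Set.inter_subset_right).trans_lt hK.measure_lt_top).ne
      have hband := isBandLimited_bandIndicator hAK hfin Set.inter_subset_right
      calc ‖∫ ξ in A, K.indicator (crossSum C g h 0) ξ‖
          = ‖(inner ℂ (bandIndicator hAK hfin) (Θ (bandIndicator hAK hfin)) : ℂ)‖ := by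
            rw [hK.inner_mixedGramian hC hcross hband hband,
              integral_crossSpectrum_bandIndicator_mul _ _ _ _ (by simp),
              setIntegral_indicator hK.measurableSet]
        _ ≤ ‖bandIndicator hAK hfin‖ * (‖Θ‖ * ‖bandIndicator hAK hfin‖) :=
            (norm_inner_le_norm _ _).trans (by gcongr; exact Θ.le_opNorm _)
        _ = ‖Θ‖ * volume.real (A ∩ K) := by rw [← norm_bandIndicator_sq hAK hfin]; ring
        _ ≤ ‖Θ‖ * volume.real A := by gcongr; exacts [hAfin.ne, Set.inter_subset_left]
  filter_upwards [hbound] with ξ hξ hξK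
  rwa [Set.indicator_of_mem hξK] at hξ

end IsWindow

theorem isFourierMultiplier_mixedGramian (hC : ∀ p, IsUnit (C p))
    (hgL : LocallyIntegrableSystem C g) (hhL : LocallyIntegrableSystem C h)
    (hcross : ∀ α ≠ 0, ∀ᵐ ξ, crossSum C g h α ξ = 0) :
    IsFourierMultiplier (mixedGramian (translationSystem C h) (translationSystem C g) hhB hgB)
      (crossSum C g h 0) := by
  obtain ⟨K, hmono, hcover, hK⟩ := exists_monotone_aecover_isWindow hgB hhB hgL hhL
  have hs : MemLp (crossSum C g h 0) ∞ volume :=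
    memLp_top_of_bound (measurable_crossSum 0).aestronglyMeasurable _
      (ae_of_forall_ae_mem_overlap (α := 0) hcover fun n => by
        simpa only [overlap_zero] using
          (hK n).ae_norm_crossSum_zero_le (hgB := hgB) (hhB := hhB) hC hcross)
  have hΨ := isFourierMultiplier_fourierMultiplierOp hs
  have hdense := dense_span_isBandLimited hcover fun n => (hK n).measure_lt_top
  suffices hΘ : mixedGramian (translationSystem C h) (translationSystem C g) hhB hgB =
      fourierMultiplierOp hs by rwa [hΘ]
  refine clm_ext_inner_of_dense_span hdense hdense ?_
  rintro f₁ ⟨m, hf₁⟩ f₂ ⟨n, hf₂⟩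
  rw [hΨ.inner_eq_integral_crossSpectrum, (hK (max m n)).inner_mixedGramian hC hcross
    (hf₁.mono (hmono (le_max_left m n))) (hf₂.mono (hmono (le_max_right m n)))]

theorem ae_crossSum_eq_zero_of_commute (hC : ∀ p, IsUnit (C p))
    (hgL : LocallyIntegrableSystem C g) (hhL : LocallyIntegrableSystem C h)
    (hcomm : ∀ x, Commute (mixedGramian (translationSystem C h) (translationSystem C g) hhB hgB)
      (translationOp x)) (hα : α ≠ 0) : ∀ᵐ ξ, crossSum C g h α ξ = 0 := by
  obtain ⟨K, -, hcover, hK⟩ := exists_monotone_aecover_isWindow hgB hhB hgL hhL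
  exact ae_of_forall_ae_mem_overlap hcover fun n => (hK n).ae_crossSum_eq_zero hC hcomm hα

theorem mem_centralizer_translationOp_iff {Θ : L2Space d →L[ℂ] L2Space d} :
    Θ ∈ Set.centralizer (Set.range (translationOp (d := d))) ↔
      ∀ x, Commute Θ (translationOp x) := by
  simp only [Set.mem_centralizer_iff, Set.forall_mem_range, Commute.symm_iff (a := Θ)]
  rfl

theorem ae_summable_crossTerm (hC : ∀ p, IsUnit (C p)) (hgB : IsBessel (translationSystem C g))
    (hhB : IsBessel (translationSystem C h)) (hgL : LocallyIntegrableSystem C g)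
    (hhL : LocallyIntegrableSystem C h) (α : EuclideanSpace ℝ (Fin d)) :
    ∀ᵐ ξ, Summable fun p : activeIndices C α => crossTerm C g h α ξ p := by
  obtain ⟨K, -, hcover, hK⟩ := exists_monotone_aecover_isWindow hgB hhB hgL hhL
  exact ae_of_forall_ae_mem_overlap hcover fun n =>
    (hK n).left.ae_summable_crossTerm hC (hK n).measurableSet (hK n).right α

end Commutant

theorem theoremT (d : ℕ) {P : Type*} [Countable P]
    (C : P → Matrix (Fin d) (Fin d) ℝ) (hC : ∀ p, IsUnit (C p))
    (g h : P → L2Space d)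
    (hgB : IsBessel (translationSystem C g)) (hhB : IsBessel (translationSystem C h))
    (hgL : LocallyIntegrableSystem C g) (hhL : LocallyIntegrableSystem C h) :
    -- `Θ = θ_g^* θ_h` is the sum of the rank one operators `⟨·, T_{C_p k} h_p⟩ T_{C_p k} g_p`
    (∀ f : L2Space d, HasSum
      (fun pk : P × (Fin d → ℤ) =>
        (inner ℂ (translationSystem C h pk) f : ℂ) • translationSystem C g pk)
      (mixedGramian (translationSystem C h) (translationSystem C g) hhB hgB f)) ∧
    -- all the series below converge (absolutely) almost everywhere
    (∀ α ∈ frequencySet C, ∀ᵐ ξ, Summable fun p : activeIndices C α => crossTerm C g h α ξ p) ∧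
    (∀ᵐ ξ, Summable fun p : P => crossTerm C g h 0 ξ p) ∧
    -- `Θ` lies in the commutant of the translations iff the cross terms cancel
    (mixedGramian (translationSystem C h) (translationSystem C g) hhB hgB ∈
        Set.centralizer (Set.range (translationOp (d := d))) ↔
      ∀ α ∈ frequencySet C \ {0}, ∀ᵐ ξ, ∑' p : activeIndices C α, crossTerm C g h α ξ p = 0) ∧
    -- in this case `Θ` is a Fourier multiplier
    (mixedGramian (translationSystem C h) (translationSystem C g) hhB hgB ∈
        Set.centralizer (Set.range (translationOp (d := d))) →
      IsFourierMultiplier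
        (mixedGramian (translationSystem C h) (translationSystem C g) hhB hgB)
        (fun ξ => ∑' p : P, crossTerm C g h 0 ξ p)) := by
  set Θ := mixedGramian (translationSystem C h) (translationSystem C g) hhB hgB
  have hcancel (hΘ : ∀ x, Commute Θ (translationOp x)) :
      ∀ α ∈ frequencySet C \ {0}, ∀ᵐ ξ, crossSum C g h α ξ = 0 := fun α hα =>
    ae_crossSum_eq_zero_of_commute hC hgL hhL hΘ hα.2
  have hmultiplier (hcross : ∀ α ∈ frequencySet C \ {0}, ∀ᵐ ξ, crossSum C g h α ξ = 0) :
      IsFourierMultiplier Θ (crossSum C g h 0) :=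
    isFourierMultiplier_mixedGramian hC hgL hhL fun α hα => by
      by_cases hαC : α ∈ frequencySet C
      · exact hcross α ⟨hαC, hα⟩
      · exact .of_forall (crossSum_of_notMem_frequencySet hC hαC)
  have hsummable := ae_summable_crossTerm hC hgB hhB hgL hhL
  rw [mem_centralizer_translationOp_iff]
  refine ⟨hasSum_mixedGramian hhB hgB, fun α _ => hsummable α, ?_,
    ⟨hcancel, fun hcross x => (hmultiplier hcross).commute (isFourierMultiplier_translationOp x)⟩,
    fun hΘ => crossSum_zero (C := C) (g := g) (h := h) ▸ hmultiplier (hcancel hΘ)⟩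
  filter_upwards [hsummable 0] with ξ hξ
  rw [activeIndices_zero] at hξ
  exact (Equiv.Set.univ P).summable_iff.1 hξ
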